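/- Let $\Omega$ be the category of finite rooted trees, a morphism $S\to T$ being a map $\Omega(S)\to\Omega(T)$ between the free symmetric coloured operads generated by the trees (the colours of $\Omega(T)$ are the edges of $T$, its generating operations are the vertices of $T$). A tree is closed if it has no leaves; let $\Omega_{cl}\subseteq\Omega$ be the full subcategory of closed trees and $\mathbf{cdSets}$ the category of presheaves of sets on $\Omega_{cl}$ (closed dendroidal sets). A closed tree $T$ is also regarded as a representable presheaf. An edge of a closed tree $T$ is inner if it is not the root edge, and very inner if moreover it is not attached to a stump (a vertex without inputs). The closed faces of $T$ are the subobjects $\partial_eT\rightarrowtail T$ obtained by contracting an inner edge $e$, together with the root face if the root vertex of $T$ is unary (obtained by deleting the root edge and the root vertex). For a very inner edge $e$, the very inner horn $\Lambda^e_{cl}T\subseteq T$ is the union of all closed faces of $T$ except $\partial_eT$. A class of morphisms is saturated if it is closed under pushouts, coproducts, transfinite compositions and retracts. The class of via (very inner anodyne) morphisms is the smallest saturated class containing all very inner horn inclusions $\Lambda^e_{cl}T\rightarrowtail T$, for all closed trees $T$ and all very inner edges $e$ of $T$. A monomorphism $X\rightarrowtail Y$ in $\mathbf{cdSets}$ is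 normal if for every closed tree $T$ the group $\mathrm{Aut}(T)$ acts freely on the complement of $X_T$ in $Y_T$. For a vertex $v$ of a closed tree $T$, let $\overline{C}_v\rightarrowtail T$ be the closed corolla whose edges are the edges of $T$ attached to $v$. The closed spine $\mathrm{cSpine}(T)\subseteq T$ is the union of the $\overline{C}_v$ over all vertices $v$ of $T$. Theorem. (a) For every closed tree $T$, the inclusion $\mathrm{cSpine}(T)\rightarrowtail T$ is a via morphism. (b) The class of via morphisms is the smallest saturated class $\mathcal W$ of morphisms of $\mathbf{cdSets}$ which contains all closed spine inclusions $\mathrm{cSpine}(T)\rightarrowtail T$ and has the following cancellation property: for all normal monomorphisms $i\colon A\rightarrowtail B$ and $j\colon B\rightarrowtail C$, if $i$ and $j\circ i$ belong to $\mathcal W$, then so does $j$. (In particular, the class of via morphisms itself has this property.) -/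

import Mathlib

open CategoryTheory

namespace Dendroidal

/-! ### Trees and the category of trees -/

/-- A finite rooted tree, given by its finite set of edges and the partial order `le` on it in
which `a` is below `b` if the path from `b` down to the root passes through `a`. Some of the
maximal (topmost) edges are marked as leaves; every other edge `e` has a vertex on top of it.
The names of the edges are natural numbers, so that trees form a (small) set; the order on the
edges has nothing to do with the order of the natural numbers. -/
structure Tree : Type where
  names : Finset ℕ
  le : {x // x ∈ names} → {x // x ∈ names} → Prop
  le_refl : ∀ a, le a a
  le_trans : ∀ a b c, le a b → le b c → le a c
  le_antisymm : ∀ a b, le a b → le b a → a = b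
  root : {x // x ∈ names}
  root_le : ∀ a, le root a
  total_below : ∀ a b e, le a e → le b e → le a b ∨ le b a
  leaves : Set {x // x ∈ names}
  leaf_maximal : ∀ e ∈ leaves, ∀ a, le e a → a = e

namespace Tree

/-- The edges of a tree. -/
def Edge (T : Tree) : Type := {x // x ∈ T.names}

instance (T : Tree) : Fintype T.Edge := inferInstanceAs (Fintype {x // x ∈ T.names})

instance (T : Tree) : DecidableEq T.Edge := inferInstanceAs (DecidableEq {x // x ∈ T.names})

instance (T : Tree) : PartialOrder T.Edge where
  le := T.le
  le_refl := T.le_refl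
  le_trans := T.le_trans
  le_antisymm := T.le_antisymm

/-- The root edge of a tree. -/
def rootEdge (T : Tree) : T.Edge := T.root

lemma rootEdge_le (T : Tree) (a : T.Edge) : T.rootEdge ≤ a := T.root_le a

/-- The set of leaves of a tree. -/
def leafSet (T : Tree) : Set T.Edge := T.leaves

lemma le_or_le_of_le {T : Tree} {a b e : T.Edge} (ha : a ≤ e) (hb : b ≤ e) : a ≤ b ∨ b ≤ a :=
  T.total_below a b e ha hb

open Classical in
/-- The edges immediately above `e`, i.e. the inputs of the vertex on top of `e` (if any). -/
noncomputable def children (T : Tree) (e : T.Edge) : Finset T.Edge :=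
  Finset.univ.filter fun c => e ⋖ c

lemma mem_children {T : Tree} {e c : T.Edge} : c ∈ T.children e ↔ e ⋖ c := by
  simp [children]

/-- The vertices of a tree: there is one on top of each edge which is not a leaf. -/
structure Vertex (T : Tree) : Type where
  output : T.Edge
  not_leaf : output ∉ T.leafSet

namespace Vertex

variable {T : Tree}

/-- The input edges of a vertex. -/
noncomputable def inputs (v : T.Vertex) : Finset T.Edge := T.children v.output

/-- A stump is a vertex without inputs. -/
def IsStump (v : T.Vertex) : Prop := v.inputs = ∅

/-- The edge `e` is attached to the vertex `v`: it is its output or one of its inputs. -/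
def Attached (v : T.Vertex) (e : T.Edge) : Prop := e = v.output ∨ e ∈ v.inputs

end Vertex

/-- An inner edge is one which is neither the root nor a leaf (so it connects two vertices). -/
def IsInner (T : Tree) (e : T.Edge) : Prop := e ≠ T.rootEdge ∧ e ∉ T.leafSet

/-- A very inner edge is an inner edge which is not attached to a stump. -/
def IsVeryInner (T : Tree) (e : T.Edge) : Prop :=
  T.IsInner e ∧ ∀ v : T.Vertex, v.Attached e → ¬ v.IsStump

/-- The operations of the free symmetric coloured operad `Ω(T)` on the vertices of `T`. Its
colours are the edges of `T`, and `Ω(T)(e₁, …, eₙ; e)` is a singleton if there is a subtree of `T`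
with root `e` and with leaves `e₁, …, eₙ` (in any order), and is empty otherwise;
`T.Op {e₁, …, eₙ} e` says that it is a singleton. Such a subtree is either the single edge `e`,
or is obtained from the vertex on top of `e` by grafting a subtree on each of its inputs. -/
inductive Op (T : Tree) : Multiset T.Edge → T.Edge → Prop
  | id (e : T.Edge) : Op T {e} e
  | node (v : T.Vertex) (L : T.Edge → Multiset T.Edge)
      (h : ∀ c ∈ v.inputs, Op T (L c) c) : Op T (∑ c ∈ v.inputs, L c) v.output

/-- A morphism of trees is a map of coloured operads `Ω(S) → Ω(T)`. Since each set of operations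
of `Ω(T)` has at most one element, this is a map on edges (colours) for which an operation
`e₁, …, eₙ → e` of `Ω(S)` gives rise to an operation `f e₁, …, f eₙ → f e` of `Ω(T)`. -/
@[ext]
structure Hom (S T : Tree) : Type where
  toFun : S.Edge → T.Edge
  map_op : ∀ (L : Multiset S.Edge) (e : S.Edge), S.Op L e → T.Op (L.map toFun) (toFun e)

/-- The category `Ω` of trees. -/
instance : Category Tree where
  Hom := Hom
  id T := ⟨fun e => e, fun L e h => by simpa using h⟩
  comp f g := ⟨fun e => g.toFun (f.toFun e), fun L e h => by
    simpa [Multiset.map_map] using g.map_op _ _ (f.map_op L e h)⟩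

/-- A tree is closed if it has no leaves. -/
def IsClosed : ObjectProperty Tree := fun T => T.leafSet = ∅

/-! In the operad of a closed tree, the operations with output `e` are indexed by the sets of
pairwise incomparable edges above `e`. -/

lemma Op.nodup_incomparable {T : Tree} {L : Multiset T.Edge} {e : T.Edge} (h : T.Op L e) :
    L.Nodup ∧ (∀ x ∈ L, e ≤ x) ∧ ∀ x ∈ L, ∀ y ∈ L, x ≤ y → x = y := by
  induction h with
  | id e => simp
  | node v L h ih =>
    have key : ∀ c ∈ v.inputs, ∀ d ∈ v.inputs, ∀ x, c ≤ x → d ≤ x → c = d := by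
      intro c hc d hd x hcx hdx
      have hc' := mem_children.1 hc
      have hd' := mem_children.1 hd
      rcases le_or_le_of_le hcx hdx with hle | hle
      · rcases hle.eq_or_lt with h' | h'
        · exact h'
        · exact absurd h' (hd'.2 hc'.1)
      · rcases hle.eq_or_lt with h' | h'
        · exact h'.symm
        · exact absurd h' (hc'.2 hd'.1)
    refine ⟨?_, ?_, ?_⟩
    · classical
      rw [Multiset.nodup_iff_count_le_one]
      intro x
      rw [Multiset.count_sum']
      by_cases hx : ∃ c ∈ v.inputs, x ∈ L c
      · obtain ⟨c, hc, hxc⟩ := hx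
        rw [Finset.sum_eq_single_of_mem c hc]
        · exact Multiset.nodup_iff_count_le_one.1 (ih c hc).1 x
        · intro d hd hdc
          rw [Multiset.count_eq_zero]
          intro hxd
          exact hdc (key d hd c hc x ((ih d hd).2.1 x hxd) ((ih c hc).2.1 x hxc))
      · push Not at hx
        rw [Finset.sum_eq_zero]
        · exact zero_le_one
        · intro d hd
          exact Multiset.count_eq_zero.2 (hx d hd)
    · intro x hx
      obtain ⟨c, hc, hxc⟩ := Multiset.mem_sum.1 hx
      exact (mem_children.1 hc).1.le.trans ((ih c hc).2.1 x hxc)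
    · intro x hx y hy hxy
      obtain ⟨c, hc, hxc⟩ := Multiset.mem_sum.1 hx
      obtain ⟨d, hd, hyd⟩ := Multiset.mem_sum.1 hy
      have hcd : c = d := key c hc d hd y (((ih c hc).2.1 x hxc).trans hxy) ((ih d hd).2.1 y hyd)
      subst hcd
      exact (ih c hc).2.2 x hxc y hyd hxy

lemma IsClosed.op {T : Tree} (hT : T.IsClosed) (e : T.Edge) :
    ∀ L : Multiset T.Edge, L.Nodup → (∀ x ∈ L, e ≤ x) →
      (∀ x ∈ L, ∀ y ∈ L, x ≤ y → x = y) → T.Op L e := by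
  classical
  induction e using (wellFounded_gt (α := T.Edge)).induction with
  | _ e ih =>
    intro L hn hle hinc
    by_cases he : e ∈ L
    · have : L = {e} := by
        rw [Multiset.Nodup.ext hn (Multiset.nodup_singleton e)]
        intro x
        rw [Multiset.mem_singleton]
        exact ⟨fun hx => (hinc e he x hx (hle x hx)).symm, fun hx => hx ▸ he⟩
      rw [this]
      exact Op.id e
    · have hv : e ∉ T.leafSet := by
        have h0 : T.leafSet = ∅ := hT
        simp [h0]
      have hL : L = ∑ c ∈ (Vertex.mk e hv).inputs, L.filter (fun x => c ≤ x) := by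
        ext x
        rw [Multiset.count_sum']
        by_cases hx : x ∈ L
        · have hlt : e < x := lt_of_le_of_ne (hle x hx) (fun h => he (by rw [h]; exact hx))
          obtain ⟨c, hc, hcx⟩ := exists_covBy_le_of_lt hlt
          rw [Finset.sum_eq_single_of_mem c (show c ∈ (Vertex.mk e hv).inputs from mem_children.2 hc)]
          · rw [Multiset.count_filter_of_pos hcx]
          · intro d hd hdc
            have hd' := mem_children.1 hd
            rw [Multiset.count_filter_of_neg]
            intro hdx
            apply hdc
            rcases le_or_le_of_le hcx hdx with h | h
            · rcases h.eq_or_lt with h' | h'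
              · exact h'.symm
              · exact absurd h' (hd'.2 hc.1)
            · rcases h.eq_or_lt with h' | h'
              · exact h'
              · exact absurd h' (hc.2 hd'.1)
        · rw [Multiset.count_eq_zero.2 hx, Finset.sum_eq_zero]
          intro d hd
          exact Multiset.count_eq_zero.2 (fun h => hx (Multiset.mem_of_mem_filter h))
      rw [hL]
      refine Op.node ⟨e, hv⟩ _ (fun c hc => ih c (mem_children.1 hc).1 _ (hn.filter _) ?_ ?_)
      · intro x hx
        exact Multiset.of_mem_filter hx
      · intro x hx y hy
        exact hinc x (Multiset.mem_of_mem_filter hx) y (Multiset.mem_of_mem_filter hy)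

/-! ### Closed trees spanned by sets of edges -/

/-- The edge of `T` with a name occurring in a set `A` of edges of `T`. -/
def edgeOf {T : Tree} {A : Finset T.Edge}
    (x : {x // x ∈ A.map (Function.Embedding.subtype (fun x => x ∈ T.names))}) : T.Edge :=
  ⟨x.1, Finset.property_of_mem_map_subtype (p := fun x => x ∈ T.names) A x.2⟩

lemma edgeOf_injective {T : Tree} {A : Finset T.Edge} :
    Function.Injective (edgeOf (T := T) (A := A)) :=
  fun _ _ h => Subtype.ext (congrArg (fun z : {x // x ∈ T.names} => z.1) h)

lemma edgeOf_mem {T : Tree} {A : Finset T.Edge}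
    (x : {x // x ∈ A.map (Function.Embedding.subtype (fun x => x ∈ T.names))}) :
    edgeOf x ∈ A := by
  obtain ⟨x, hx⟩ := x
  obtain ⟨a, ha, rfl⟩ := Finset.mem_map.1 hx
  exact ha

/-- The closed tree whose edges are the elements of a set `A` of edges of `T` having a least
element `r`, with the induced order: all edges of `T` outside `A` are contracted or cut off, and
each topmost edge carries a stump. -/
def span (T : Tree) (A : Finset T.Edge) (r : T.Edge) (hr : r ∈ A) (hA : ∀ a ∈ A, r ≤ a) : Tree where
  names := A.map (Function.Embedding.subtype (fun x => x ∈ T.names))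
  le x y := edgeOf x ≤ edgeOf y
  le_refl _ := le_rfl
  le_trans _ _ _ h h' := _root_.le_trans h h'
  le_antisymm _ _ h h' := edgeOf_injective (_root_.le_antisymm h h')
  root := ⟨r.1, Finset.mem_map_of_mem (Function.Embedding.subtype (fun x => x ∈ T.names)) hr⟩
  root_le x := hA _ (edgeOf_mem x)
  total_below _ _ _ hae hbe := le_or_le_of_le hae hbe
  leaves := ∅
  leaf_maximal e he := absurd he (Set.notMem_empty e)

variable {T : Tree} {A : Finset T.Edge} {r : T.Edge} {hr : r ∈ A} {hA : ∀ a ∈ A, r ≤ a}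

lemma isClosed_span : (T.span A r hr hA).IsClosed := rfl

/-- The edges of the tree spanned by `A` are edges of `T`. -/
def spanEdge (x : (T.span A r hr hA).Edge) : T.Edge := edgeOf (A := A) x

lemma spanEdge_injective : Function.Injective (spanEdge (T := T) (hr := hr) (hA := hA)) :=
  edgeOf_injective

lemma spanEdge_le_iff {x y : (T.span A r hr hA).Edge} : spanEdge x ≤ spanEdge y ↔ x ≤ y := Iff.rfl

/-- For a closed tree `T`, the inclusion of edges is a morphism from the tree spanned by `A`
to `T`. -/
def spanHom (hT : T.IsClosed) (A : Finset T.Edge) (r : T.Edge) (hr : r ∈ A)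
    (hA : ∀ a ∈ A, r ≤ a) : T.span A r hr hA ⟶ T where
  toFun := spanEdge
  map_op L e h := by
    obtain ⟨h1, h2, h3⟩ := h.nodup_incomparable
    apply hT.op
    · exact h1.map spanEdge_injective
    · intro x hx
      obtain ⟨a, ha, rfl⟩ := Multiset.mem_map.1 hx
      exact spanEdge_le_iff.2 (h2 a ha)
    · intro x hx y hy hxy
      obtain ⟨a, ha, rfl⟩ := Multiset.mem_map.1 hx
      obtain ⟨b, hb, rfl⟩ := Multiset.mem_map.1 hy
      rw [h3 a ha b hb (spanEdge_le_iff.1 hxy)]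

end Tree

/-- The category `Ω_cl` of closed trees, a full subcategory of the category of trees. -/
abbrev ClosedTree : Type := Tree.IsClosed.FullSubcategory

namespace ClosedTree

/-- The vertex on top of the root of a closed tree. -/
def rootVertex (T : ClosedTree) : T.obj.Vertex where
  output := T.obj.rootEdge
  not_leaf := by
    have h : T.obj.leafSet = ∅ := T.property
    simp [h]

/-- The inner face of a closed tree contracting the inner edge `e`. -/
noncomputable def innerFace (T : ClosedTree) (e : T.obj.Edge) (he : T.obj.IsInner e) :
    ClosedTree :=
  ⟨T.obj.span (Finset.univ.erase e) T.obj.rootEdge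
    (Finset.mem_erase.2 ⟨he.1.symm, Finset.mem_univ _⟩) (fun a _ => T.obj.rootEdge_le a),
    Tree.isClosed_span⟩

/-- The inclusion of an inner face. -/
noncomputable def innerFaceMap (T : ClosedTree) (e : T.obj.Edge) (he : T.obj.IsInner e) :
    T.innerFace e he ⟶ T :=
  ObjectProperty.homMk (Tree.spanHom T.property (Finset.univ.erase e) T.obj.rootEdge
    (Finset.mem_erase.2 ⟨he.1.symm, Finset.mem_univ _⟩) (fun a _ => T.obj.rootEdge_le a))

lemma le_of_rootVertex_inputs (T : ClosedTree) (c : T.obj.Edge)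
    (hc : T.rootVertex.inputs = {c}) (a : T.obj.Edge) (ha : a ∈ Finset.univ.erase T.obj.rootEdge) :
    c ≤ a := by
  have hlt : T.obj.rootEdge < a :=
    lt_of_le_of_ne (T.obj.rootEdge_le a) (Finset.ne_of_mem_erase ha).symm
  obtain ⟨d, hd, hda⟩ := exists_covBy_le_of_lt hlt
  have hd' : d ∈ T.rootVertex.inputs := Tree.mem_children.2 hd
  rw [hc, Finset.mem_singleton] at hd'
  exact hd' ▸ hda

lemma mem_erase_of_rootVertex_inputs (T : ClosedTree) (c : T.obj.Edge)
    (hc : T.rootVertex.inputs = {c}) : c ∈ Finset.univ.erase T.obj.rootEdge := by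
  have h : c ∈ T.rootVertex.inputs := by simp [hc]
  exact Finset.mem_erase.2 ⟨(Tree.mem_children.1 h).1.ne', Finset.mem_univ _⟩

/-- The root face of a closed tree whose root vertex is unary, with unique input `c`: the root
edge and the root vertex are removed, and `c` becomes the root. -/
noncomputable def rootFace (T : ClosedTree) (c : T.obj.Edge) (hc : T.rootVertex.inputs = {c}) :
    ClosedTree :=
  ⟨T.obj.span (Finset.univ.erase T.obj.rootEdge) c (T.mem_erase_of_rootVertex_inputs c hc)
    (T.le_of_rootVertex_inputs c hc), Tree.isClosed_span⟩

/-- The inclusion of the root face. -/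
noncomputable def rootFaceMap (T : ClosedTree) (c : T.obj.Edge)
    (hc : T.rootVertex.inputs = {c}) : T.rootFace c hc ⟶ T :=
  ObjectProperty.homMk (Tree.spanHom T.property (Finset.univ.erase T.obj.rootEdge) c
    (T.mem_erase_of_rootVertex_inputs c hc) (T.le_of_rootVertex_inputs c hc))

lemma output_le_of_mem {T : ClosedTree} (v : T.obj.Vertex) (a : T.obj.Edge)
    (ha : a ∈ insert v.output v.inputs) : v.output ≤ a := by
  rcases Finset.mem_insert.1 ha with rfl | h
  · exact le_rfl
  · exact (Tree.mem_children.1 h).1.le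

/-- The closed corolla at a vertex `v`: its edges are the edges attached to `v`, and each input
of `v` carries a stump. -/
noncomputable def corolla (T : ClosedTree) (v : T.obj.Vertex) : ClosedTree :=
  ⟨T.obj.span (insert v.output v.inputs) v.output (Finset.mem_insert_self _ _)
    (output_le_of_mem v), Tree.isClosed_span⟩

/-- The map from the closed corolla at `v` to `T` which is the inclusion on edges. -/
noncomputable def corollaMap (T : ClosedTree) (v : T.obj.Vertex) : T.corolla v ⟶ T :=
  ObjectProperty.homMk (Tree.spanHom T.property (insert v.output v.inputs) v.output
    (Finset.mem_insert_self _ _) (output_le_of_mem v))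

end ClosedTree

/-! ### Closed dendroidal sets -/

/-- Closed dendroidal sets: presheaves of sets on the category of closed trees. -/
abbrev ClosedDendroidalSet : Type 1 := ClosedTreeᵒᵖ ⥤ Type

/-- The very inner horn of `T` at `e`: the union, inside the representable presheaf `T`, of all
closed faces of `T` (the inner faces, and the root face if it exists) except the one
contracting `e`. -/
noncomputable def horn (T : ClosedTree) (e : T.obj.Edge) : Subfunctor (yoneda.obj T) :=
  (⨆ (d : T.obj.Edge) (hd : T.obj.IsInner d) (_ : d ≠ e),
      Subfunctor.range (yoneda.map (T.innerFaceMap d hd))) ⊔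
    ⨆ (c : T.obj.Edge) (hc : T.rootVertex.inputs = {c}),
      Subfunctor.range (yoneda.map (T.rootFaceMap c hc))

/-- The closed spine of `T`: the union, inside the representable presheaf `T`, of the closed
corollas at all vertices of `T`. -/
noncomputable def closedSpine (T : ClosedTree) : Subfunctor (yoneda.obj T) :=
  ⨆ v : T.obj.Vertex, Subfunctor.range (yoneda.map (T.corollaMap v))

/-- A monomorphism `X ⟶ Y` of closed dendroidal sets is normal if for each closed tree `T` the
group `Aut T` acts freely on the complement of `X(T)` in `Y(T)`. -/
def IsNormalMono {X Y : ClosedDendroidalSet} (i : X ⟶ Y) : Prop :=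
  Mono i ∧ ∀ (T : ClosedTree) (y : Y.obj (Opposite.op T)),
    y ∉ (Subfunctor.range i).obj (Opposite.op T) →
      ∀ g : T ≅ T, Y.map g.hom.op y = y → g = Iso.refl T

/-- A class of morphisms is saturated if it is closed under pushouts, (small) coproducts,
(small) transfinite compositions and retracts. It then contains all isomorphisms. -/
structure IsSaturated (W : MorphismProperty ClosedDendroidalSet) : Prop where
  pushouts : W.IsStableUnderCobaseChange
  coproducts : MorphismProperty.IsStableUnderCoproducts.{0} W
  transfinite : MorphismProperty.IsStableUnderTransfiniteComposition.{0} W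
  retracts : W.IsStableUnderRetracts

/-- The saturation of a class of morphisms: the intersection of all the saturated classes
containing it. -/
def saturation (I : MorphismProperty ClosedDendroidalSet) : MorphismProperty ClosedDendroidalSet :=
  fun _ _ f => ∀ W : MorphismProperty ClosedDendroidalSet, IsSaturated W → I ≤ W → W f

/-- The class of very inner horn inclusions. -/
inductive VeryInnerHornInclusion : MorphismProperty ClosedDendroidalSet
  | mk (T : ClosedTree) (e : T.obj.Edge) (he : T.obj.IsVeryInner e) :
      VeryInnerHornInclusion (horn T e).ι

/-- The class of very inner anodyne morphisms. -/
def via : MorphismProperty ClosedDendroidalSet := saturation VeryInnerHornInclusion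

/-- The class of closed spine inclusions. -/
inductive ClosedSpineInclusion : MorphismProperty ClosedDendroidalSet
  | mk (T : ClosedTree) : ClosedSpineInclusion (closedSpine T).ι

/-- Right cancellation among normal monomorphisms. -/
def HasRightCancellation (W : MorphismProperty ClosedDendroidalSet) : Prop :=
  ∀ ⦃A B C : ClosedDendroidalSet⦄ (i : A ⟶ B) (j : B ⟶ C),
    IsNormalMono i → IsNormalMono j → W i → W (i ≫ j) → W j

end Dendroidal

open Dendroidal

/-! In a closed tree an operation is a set of pairwise incomparable edges above its output, so a
morphism of closed trees is a monotone map on edges that keeps incomparable edges incomparable.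
Membership in a very inner horn or in the closed spine then depends only on which edges are hit
(`mem_horn_iff`, `mem_closedSpine_iff`). By the small object argument, via morphisms are those with
the left lifting property against all maps having the right lifting property against very inner
horns (`via_eq_llp_rlp`).

Cancellation (`hasRightCancellation_via`) is a homotopy argument. Factor `j = k ≫ p` with `k` via
and `p` in the right lifting class. Since `i ≫ j` is via, `p` has a section `s` for which `j ≫ s`
and `k` agree on `A`. The presheaf `labelings` serves as an interval. The pushout-product of its two
ends with a horn is via (`llp_rlp_hornPrism`), so there is a homotopy over `C` from `j ≫ s` to `k`.
The pushout-product of one end with a boundary is via as well (`llp_rlp_boundaryPrism`), so the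
normal monomorphism `j` allows the homotopy to be extended to `C`, starting at `s`. It ends at a
section `s'` of `p` with `j ≫ s' = k`, and `j` is a retract of `k`. Both prism statements come from
`llp_rlp_labelSub`, which pairs each missing section with the one obtained by inserting a
distinguished edge, and fills the pair by one horn.

For the comparison of spines with horns, let `W` be saturated with cancellation. If `W` contains the
spine inclusions of all trees smaller than `T`, then it contains the inclusion of the spine of `T`
into each very inner horn of `T` (`IsSaturated.faceInclusion_horn`): the faces of the horn are glued
on one at a time. Given this, horns follow from spines by cancellation, and spines follow from horns
by composition and induction on the number of edges. The bookkeeping takes place in the lattice of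
families of subtrees of `T`. -/

namespace Dendroidal

open Opposite

/-! ### Morphisms of closed trees as maps of tree orders -/

namespace ClosedTree

/-- The map on edges underlying a morphism of closed trees. -/
def fn {S T : ClosedTree} (f : S ⟶ T) : S.obj.Edge → T.obj.Edge := f.hom.toFun

@[simp] lemma fn_comp {R S T : ClosedTree} (f : R ⟶ S) (g : S ⟶ T) (x : R.obj.Edge) :
    fn (f ≫ g) x = fn g (fn f x) := rfl

@[simp] lemma fn_id (T : ClosedTree) (x : T.obj.Edge) : fn (𝟙 T) x = x := rfl

lemma hom_ext {S T : ClosedTree} {f g : S ⟶ T} (h : ∀ x, fn f x = fn g x) : f = g :=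
  ObjectProperty.hom_ext _ (Tree.Hom.ext (funext h))

lemma op_of_pairwise (T : ClosedTree) (e : T.obj.Edge) (L : Multiset T.obj.Edge) (h : L.Nodup)
    (h' : ∀ x ∈ L, e ≤ x) (h'' : ∀ x ∈ L, ∀ y ∈ L, x ≤ y → x = y) : T.obj.Op L e :=
  Tree.IsClosed.op T.property e L h h' h''

lemma fn_mono {S T : ClosedTree} (f : S ⟶ T) {a b : S.obj.Edge} (h : a ≤ b) : fn f a ≤ fn f b := by
  have h1 := f.hom.map_op {b} a (op_of_pairwise S a {b} (Multiset.nodup_singleton b)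
    (by simpa using h) (by simp))
  exact h1.nodup_incomparable.2.1 _ (by simp [fn])

/-- Two incomparable edges are the inputs of an operation with output the root, and the inputs of
its image must again be distinct and incomparable. -/
lemma comparable_of_fn_le {S T : ClosedTree} (f : S ⟶ T) {a b : S.obj.Edge}
    (h : fn f a ≤ fn f b) : a ≤ b ∨ b ≤ a := by
  by_contra! hab
  have hne : a ≠ b := fun h => hab.1 h.le
  have h1 := f.hom.map_op {a, b} S.obj.rootEdge (op_of_pairwise S _ {a, b}
    (by simpa using hne) (fun x _ => S.obj.rootEdge_le x) (by
      intro x hx y hy hxy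
      simp only [Multiset.insert_eq_cons, Multiset.mem_cons, Multiset.mem_singleton] at hx hy
      rcases hx with rfl | rfl <;> rcases hy with rfl | rfl
      · rfl
      · exact absurd hxy hab.1
      · exact absurd hxy hab.2
      · rfl))
  obtain ⟨hn, -, hi⟩ := h1.nodup_incomparable
  have := hi (fn f a) (by simp [fn]) (fn f b) (by simp [fn]) h
  simp [fn] at this hn
  exact hn this

lemma lt_of_fn_lt {S T : ClosedTree} (f : S ⟶ T) {a b : S.obj.Edge}
    (h : fn f a < fn f b) : a < b := by
  rcases comparable_of_fn_le f h.le with h' | h'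
  · exact lt_of_le_of_ne h' (fun hab => h.ne (by rw [hab]))
  · exact absurd (fn_mono f h') h.not_ge

/-- A morphism of closed trees is the same as a monotone map which preserves incomparability. -/
def ofFn {S T : ClosedTree} (φ : S.obj.Edge → T.obj.Edge) (h : ∀ a b, a ≤ b → φ a ≤ φ b)
    (h' : ∀ a b, φ a ≤ φ b → a ≤ b ∨ b ≤ a) : S ⟶ T :=
  ObjectProperty.homMk (P := Tree.IsClosed)
  { toFun := φ
    map_op := by
      intro L e hL
      obtain ⟨h1, h2, h3⟩ := hL.nodup_incomparable
      have key : ∀ x ∈ L, ∀ y ∈ L, φ x ≤ φ y → x = y := by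
        intro x hx y hy hxy
        rcases h' x y hxy with h4 | h4
        · exact h3 x hx y hy h4
        · exact (h3 y hy x hx h4).symm
      apply op_of_pairwise T
      · exact (Multiset.nodup_map_iff_of_inj_on fun x hx y hy hxy => key x hx y hy hxy.le).2 h1
      · simpa using fun a ha => h _ _ (h2 a ha)
      · intro x hx y hy hxy
        obtain ⟨a, ha, rfl⟩ := Multiset.mem_map.1 hx
        obtain ⟨b, hb, rfl⟩ := Multiset.mem_map.1 hy
        rw [key a ha b hb hxy] }

@[simp] lemma fn_ofFn {S T : ClosedTree} (φ : S.obj.Edge → T.obj.Edge)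
    (h : ∀ a b, a ≤ b → φ a ≤ φ b) (h' : ∀ a b, φ a ≤ φ b → a ≤ b ∨ b ≤ a) (x : S.obj.Edge) :
    fn (ofFn φ h h') x = φ x := rfl

/-- A map on edges lifting a morphism through a morphism is itself a morphism. -/
lemma exists_hom_of_comp {R S T : ClosedTree} (f : S ⟶ T) (g : R ⟶ T)
    (φ : R.obj.Edge → S.obj.Edge) (h : ∀ r, fn f (φ r) = fn g r)
    (h' : ∀ a b, a ≤ b → fn g a = fn g b → φ a ≤ φ b) :
    ∃ σ : R ⟶ S, σ ≫ f = g ∧ ∀ r, fn σ r = φ r := by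
  refine ⟨ofFn φ ?_ ?_, hom_ext h, fun r => rfl⟩
  · intro a b hab
    rcases (fn_mono g hab).eq_or_lt with h1 | h1
    · exact h' a b hab h1
    · exact (lt_of_fn_lt f (by rwa [h, h])).le
  · intro a b hab
    have := fn_mono f hab
    rw [h, h] at this
    exact comparable_of_fn_le g this

/-- The lift is chosen as a function of the image in `T` alone, so it is constant on the fibres of
`g` and hence monotone there. One value of the choice can be prescribed, which later yields sections
through a given edge. -/
lemma exists_lift_apply {R S T : ClosedTree} (f : S ⟶ T) (g : R ⟶ T)
    (h : Set.range (fn g) ⊆ Set.range (fn f)) (s : S.obj.Edge) :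
    ∃ σ : R ⟶ S, σ ≫ f = g ∧ ∀ r, fn g r = fn f s → fn σ r = s := by
  classical
  have hc : ∀ t, ∃ x, (t ∈ Set.range (fn f) → fn f x = t) ∧ (t = fn f s → x = s) := by
    intro t
    by_cases ht : t = fn f s
    · exact ⟨s, fun _ => ht.symm, fun _ => rfl⟩
    · by_cases ht' : t ∈ Set.range (fn f)
      · obtain ⟨x, hx⟩ := ht'
        exact ⟨x, fun _ => hx, fun h => absurd h ht⟩
      · exact ⟨s, fun h => absurd h ht', fun _ => rfl⟩
  choose c hc hc' using hc
  obtain ⟨σ, h1, h2⟩ := exists_hom_of_comp f g (fun r => c (fn g r))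
    (fun r => hc _ (h ⟨r, rfl⟩)) (fun a b _ hab => by rw [hab])
  exact ⟨σ, h1, fun r hr => (h2 r).trans (hc' _ hr)⟩

lemma exists_lift {R S T : ClosedTree} (f : S ⟶ T) (g : R ⟶ T)
    (h : Set.range (fn g) ⊆ Set.range (fn f)) : ∃ σ : R ⟶ S, σ ≫ f = g := by
  obtain ⟨σ, h, -⟩ := exists_lift_apply f g h S.obj.rootEdge
  exact ⟨σ, h⟩

lemma exists_section {S T : ClosedTree} (f : S ⟶ T) (h : Function.Surjective (fn f))
    (s : S.obj.Edge) : ∃ σ : T ⟶ S, σ ≫ f = 𝟙 T ∧ fn σ (fn f s) = s := by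
  obtain ⟨σ, h1, h2⟩ := exists_lift_apply f (𝟙 T) (fun t _ => h t) s
  exact ⟨σ, h1, h2 _ rfl⟩

/-- A surjective endomorphism over another tree is the identity. -/
lemma eq_id_of_comp_eq {S T : ClosedTree} (f : S ⟶ T) (u : S ⟶ S) (h : u ≫ f = f)
    (hu : Function.Surjective (fn u)) : u = 𝟙 S := by
  have hinj : Function.Injective (fn u) := Finite.injective_iff_surjective.2 hu
  have hf : ∀ x, fn f (fn u x) = fn f x := fun x => by rw [← fn_comp, h]
  apply hom_ext
  intro s
  induction s using (wellFounded_lt (α := S.obj.Edge)).induction with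
  | _ s ih =>
    rw [fn_id]
    by_contra hne
    -- If `u s < s`, then `u s` is fixed by induction, against injectivity. If `s < u s`, then the
    -- preimage of `s` lies below `s`, hence is fixed, hence equals `s`.
    rcases comparable_of_fn_le f (hf s).le with h1 | h1
    · exact hne (hinj (ih _ (lt_of_le_of_ne h1 hne)))
    · obtain ⟨t, ht⟩ := hu s
      have hlt : fn u t < fn u s := by
        rw [ht]
        exact lt_of_le_of_ne h1 (Ne.symm hne)
      have h2 := ih t (lt_of_fn_lt u hlt)
      rw [fn_id] at h2
      rw [h2] at ht
      rw [ht] at hlt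
      exact hlt.false

lemma isIso_of_bijective {S T : ClosedTree} (f : S ⟶ T) (h : Function.Bijective (fn f)) :
    IsIso f := by
  obtain ⟨σ, h1, -⟩ := exists_section f h.2 S.obj.rootEdge
  refine ⟨σ, hom_ext fun x => h.1 ?_, h1⟩
  rw [fn_id, fn_comp, ← fn_comp σ f, h1, fn_id]

lemma mono_of_injective {S T : ClosedTree} (f : S ⟶ T) (h : Function.Injective (fn f)) :
    Mono f :=
  ⟨fun g g' hg => hom_ext fun x => h (by rw [← fn_comp, hg, fn_comp])⟩

lemma range_fn_spanHom (T : ClosedTree) (A : Finset T.obj.Edge) (r : T.obj.Edge) (hr : r ∈ A)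
    (hA : ∀ a ∈ A, r ≤ a) :
    Set.range (Tree.spanHom T.property A r hr hA).toFun = A := by
  ext x
  constructor
  · rintro ⟨y, rfl⟩
    exact Tree.edgeOf_mem y
  · intro hx
    exact ⟨⟨x.1, Finset.mem_map_of_mem (Function.Embedding.subtype (fun x => x ∈ T.obj.names)) hx⟩,
      rfl⟩

/-- A set of edges with a least element is the set of edges of a subtree. -/
lemma exists_subtree (T : ClosedTree) (A : Set T.obj.Edge) (r : T.obj.Edge) (hr : r ∈ A)
    (hA : ∀ a ∈ A, r ≤ a) :
    ∃ (S : ClosedTree) (f : S ⟶ T), Function.Injective (fn f) ∧ Set.range (fn f) = A ∧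
      fn f S.obj.rootEdge = r := by
  classical
  let B : Finset T.obj.Edge := Finset.univ.filter (· ∈ A)
  have hB : r ∈ B := by simpa [B] using hr
  have hB' : ∀ a ∈ B, r ≤ a := by simpa [B] using hA
  refine ⟨⟨T.obj.span B r hB hB', Tree.isClosed_span⟩,
    ObjectProperty.homMk (Tree.spanHom T.property B r hB hB'),
    Tree.spanEdge_injective (hr := hB) (hA := hB'), ?_, rfl⟩
  refine (range_fn_spanHom T B r hB hB').trans ?_
  ext; simp [B]

/-! ### Faces, horns and spines in terms of the edges that are hit -/

lemma range_innerFaceMap (T : ClosedTree) (e : T.obj.Edge) (he : T.obj.IsInner e) :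
    Set.range (fn (T.innerFaceMap e he)) = {e}ᶜ := by
  refine (range_fn_spanHom T _ _ _ _).trans ?_
  ext; simp

lemma range_rootFaceMap (T : ClosedTree) (c : T.obj.Edge) (hc : T.rootVertex.inputs = {c}) :
    Set.range (fn (T.rootFaceMap c hc)) = {T.obj.rootEdge}ᶜ := by
  refine (range_fn_spanHom T _ _ _ _).trans ?_
  ext; simp

lemma injective_innerFaceMap (T : ClosedTree) (e : T.obj.Edge) (he : T.obj.IsInner e) :
    Function.Injective (fn (T.innerFaceMap e he)) :=
  Tree.edgeOf_injective (T := T.obj) (A := Finset.univ.erase e)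

lemma injective_rootFaceMap (T : ClosedTree) (c : T.obj.Edge) (hc : T.rootVertex.inputs = {c}) :
    Function.Injective (fn (T.rootFaceMap c hc)) :=
  Tree.edgeOf_injective (T := T.obj) (A := Finset.univ.erase T.obj.rootEdge)

lemma range_corollaMap (T : ClosedTree) (v : T.obj.Vertex) :
    Set.range (fn (T.corollaMap v)) = {x | x = v.output ∨ v.output ⋖ x} := by
  refine (range_fn_spanHom T _ _ _ _).trans ?_
  ext; simp [Tree.Vertex.inputs, Tree.mem_children]

lemma notMem_leafSet (T : ClosedTree) (e : T.obj.Edge) : e ∉ T.obj.leafSet := by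
  have h : T.obj.leafSet = ∅ := T.property
  simp [h]

lemma isInner_iff {T : ClosedTree} {e : T.obj.Edge} :
    T.obj.IsInner e ↔ e ≠ T.obj.rootEdge := by
  simp [Tree.IsInner, notMem_leafSet]

lemma rootEdge_lt {T : ClosedTree} {e : T.obj.Edge} (h : e ≠ T.obj.rootEdge) :
    T.obj.rootEdge < e := lt_of_le_of_ne (T.obj.rootEdge_le e) h.symm

lemma isVeryInner_iff {T : ClosedTree} {e : T.obj.Edge} :
    T.obj.IsVeryInner e ↔ e ≠ T.obj.rootEdge ∧ ∃ x, e < x := by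
  rw [Tree.IsVeryInner, isInner_iff]
  refine and_congr_right fun he => ?_
  constructor
  · intro h
    have := h ⟨e, T.notMem_leafSet e⟩ (Or.inl rfl)
    obtain ⟨x, hx⟩ := Finset.nonempty_iff_ne_empty.2 this
    exact ⟨x, (Tree.mem_children.1 hx).1⟩
  · rintro ⟨x, hx⟩ v (rfl | hv) h
    · obtain ⟨d, hd, -⟩ := exists_covBy_le_of_lt hx
      have hd' : d ∈ v.inputs := Tree.mem_children.2 hd
      rw [h] at hd'
      simp at hd'
    · rw [h] at hv
      simp at hv

lemma range_yoneda_map_iff {S T R : ClosedTree} (f : S ⟶ T) (g : R ⟶ T) :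
    g ∈ (Subfunctor.range (yoneda.map f)).obj (op R) ↔ Set.range (fn g) ⊆ Set.range (fn f) := by
  constructor
  · rintro ⟨h, rfl⟩ _ ⟨x, rfl⟩
    exact ⟨fn h x, rfl⟩
  · intro h
    obtain ⟨σ, hσ⟩ := exists_lift f g h
    exact ⟨σ, hσ⟩

/-- The delicate case is a map missing only the root and possibly `e`, because the root face exists
only over a unary root vertex. The image lies above one child `c` of the root and contains all other
edges; among these is an edge above `e`, which forces `c ≤ e`. So `c` is the only child. -/
lemma mem_horn_iff {S T : ClosedTree} {e : T.obj.Edge} (he : T.obj.IsVeryInner e) (f : S ⟶ T) :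
    f ∈ (horn T e).obj (op S) ↔ ∃ d, d ≠ e ∧ d ∉ Set.range (fn f) := by
  rw [isVeryInner_iff] at he
  constructor
  · intro h
    simp only [horn, Subfunctor.max_obj, Subfunctor.iSup_obj, Set.mem_union, Set.mem_iUnion] at h
    rcases h with ⟨d, hd, hde, h⟩ | ⟨c, hc, h⟩
    · rw [range_yoneda_map_iff, range_innerFaceMap] at h
      exact ⟨d, hde, fun hd => h hd rfl⟩
    · rw [range_yoneda_map_iff, range_rootFaceMap] at h
      exact ⟨_, he.1.symm, fun hd => h hd rfl⟩
  · rintro ⟨d, hde, hd⟩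
    simp only [horn, Subfunctor.max_obj, Subfunctor.iSup_obj, Set.mem_union, Set.mem_iUnion]
    by_cases hr : ∃ d, d ≠ e ∧ d ∉ Set.range (fn f) ∧ d ≠ T.obj.rootEdge
    · obtain ⟨d, hde, hd, hdr⟩ := hr
      refine Or.inl ⟨d, isInner_iff.2 hdr, hde, ?_⟩
      rw [range_yoneda_map_iff, range_innerFaceMap]
      exact Set.subset_compl_singleton_iff.2 hd
    · push Not at hr
      obtain rfl : d = T.obj.rootEdge := hr d hde hd
      have hlt := rootEdge_lt he.1
      obtain ⟨x, hx⟩ := he.2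
      have hne : fn f S.obj.rootEdge ≠ T.obj.rootEdge := fun h => hd ⟨_, h⟩
      obtain ⟨c, hc, hcf⟩ := exists_covBy_le_of_lt (rootEdge_lt hne)
      have hall : ∀ y, T.obj.rootEdge < y → y ≠ e → c ≤ y := by
        intro y hy hye
        by_contra hcy
        refine hy.ne' (hr y hye ?_)
        rintro ⟨s, rfl⟩
        exact hcy (hcf.trans (fn_mono f (S.obj.rootEdge_le s)))
      have hce : c ≤ e := by
        have hcx := hall x (hlt.trans hx) hx.ne'
        rcases Tree.le_or_le_of_le hcx hx.le with h | h
        · exact h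
        · rcases h.eq_or_lt with h' | h'
          · exact h'.ge
          · exact absurd h' (hc.2 hlt)
      refine Or.inr ⟨c, ?_, ?_⟩
      · ext y
        simp only [Tree.Vertex.inputs, Tree.mem_children, Finset.mem_singleton]
        constructor
        · intro hy
          have hcy : c ≤ y := by
            by_cases hye : y = e
            · exact hye ▸ hce
            · exact hall y hy.1 hye
          rcases hcy.eq_or_lt with h' | h'
          · exact h'.symm
          · exact absurd h' (hy.2 hc.1)
        · rintro rfl
          exact hc
      · rw [range_yoneda_map_iff, range_rootFaceMap]
        exact Set.subset_compl_singleton_iff.2 hd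

/-- Keeping `e` in the face is the point: restricting a marked section to such a face leaves it
marked and has fewer edges. -/
lemma exists_face_of_mem_horn {S T : ClosedTree} {e : T.obj.Edge} (he : T.obj.IsVeryInner e)
    {f : S ⟶ T} (hf : f ∈ (horn T e).obj (op S)) :
    ∃ (R : ClosedTree) (i : R ⟶ T) (σ : S ⟶ R), Function.Injective (fn i) ∧
      ¬ Function.Surjective (fn i) ∧ e ∈ Set.range (fn i) ∧ σ ≫ i = f := by
  rw [isVeryInner_iff] at he
  simp only [horn, Subfunctor.max_obj, Subfunctor.iSup_obj, Set.mem_union, Set.mem_iUnion] at hf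
  rcases hf with ⟨d, hd, hde, σ, rfl⟩ | ⟨c, hc, σ, rfl⟩
  · refine ⟨_, T.innerFaceMap d hd, σ, injective_innerFaceMap T d hd, ?_, ?_, rfl⟩
    · intro h
      have := h d
      rw [← Set.mem_range, range_innerFaceMap] at this
      exact this rfl
    · rw [range_innerFaceMap]
      exact hde.symm
  · refine ⟨_, T.rootFaceMap c hc, σ, injective_rootFaceMap T c hc, ?_, ?_, rfl⟩
    · intro h
      have := h T.obj.rootEdge
      rw [← Set.mem_range, range_rootFaceMap] at this
      exact this rfl
    · rw [range_rootFaceMap]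
      exact he.1

lemma mem_closedSpine_iff {S T : ClosedTree} (f : S ⟶ T) :
    f ∈ (closedSpine T).obj (op S) ↔ ∃ v, ∀ s, fn f s = v ∨ v ⋖ fn f s := by
  simp only [closedSpine, Subfunctor.iSup_obj, Set.mem_iUnion]
  constructor
  · rintro ⟨v, hv⟩
    rw [range_yoneda_map_iff, range_corollaMap, Set.range_subset_iff] at hv
    exact ⟨v.output, hv⟩
  · rintro ⟨v, hv⟩
    refine ⟨⟨v, T.notMem_leafSet v⟩, ?_⟩
    rw [range_yoneda_map_iff, range_corollaMap, Set.range_subset_iff]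
    exact hv

/-- Every finite poset with a least element and totally ordered lower sets is a closed tree. -/
lemma exists_equiv (P : Type) [Fintype P] (le : P → P → Prop) (hrefl : ∀ a, le a a)
    (htrans : ∀ a b c, le a b → le b c → le a c) (hanti : ∀ a b, le a b → le b a → a = b)
    (r : P) (hr : ∀ a, le r a) (h : ∀ a b e : P, le a e → le b e → le a b ∨ le b a) :
    ∃ (S : ClosedTree) (ε : S.obj.Edge ≃ P), ∀ x y, x ≤ y ↔ le (ε x) (ε y) := by
  classical
  let ε : {x // x ∈ Finset.range (Fintype.card P)} ≃ P :=
    (Equiv.subtypeEquivRight (by simp)).trans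
      ((Fin.equivSubtype (n := Fintype.card P)).symm.trans (Fintype.equivFin P).symm)
  let S : Tree :=
  { names := Finset.range (Fintype.card P)
    le := fun a b => le (ε a) (ε b)
    le_refl := fun a => hrefl _
    le_trans := fun a b c => htrans _ _ _
    le_antisymm := fun a b h h' => ε.injective (hanti _ _ h h')
    root := ε.symm r
    root_le := fun a => by simpa using hr (ε a)
    total_below := fun a b e => h _ _ _
    leaves := ∅
    leaf_maximal := fun e he => absurd he (Set.notMem_empty e) }
  exact ⟨⟨S, rfl⟩, ε, fun x y => Iff.rfl⟩

end ClosedTree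

/-! ### Attaching cells by Zorn's lemma -/

/-- The graph formulation of the attachment of cells: if a subfunctor `X'` is obtained from `X` by
repeatedly attaching representables along inclusions in `I`, possibly keeping an invariant `C`,
then `X ⟶ X'` has the left lifting property with respect to `I.rlp`. -/
theorem llp_rlp_homOfLe_of_attach (I : MorphismProperty ClosedDendroidalSet)
    {Y : ClosedDendroidalSet} (X X' : Subfunctor Y) (hX : X ≤ X') (C : Subfunctor Y → Prop)
    (hC : ∀ c : Set (Subfunctor Y), c.Nonempty → (∀ Z ∈ c, C Z) → C (sSup c)) (hCX : C X)
    (step : ∀ Z, X ≤ Z → Z ≤ X' → C Z → Z ≠ X' →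
      ∃ (S : ClosedTree) (y : Y.obj (op S)) (K : Subfunctor (yoneda.obj S)),
        I K.ι ∧ y ∈ X'.obj (op S) ∧ y ∉ Z.obj (op S) ∧
        (∀ (R : ClosedTree) (g : R ⟶ S), g ∈ K.obj (op R) ↔ Y.map g.op y ∈ Z.obj (op R)) ∧
        (∀ (R : ClosedTree) (g g' : R ⟶ S), g ∉ K.obj (op R) → g' ∉ K.obj (op R) →
          Y.map g.op y = Y.map g'.op y → g = g') ∧
        C (Z ⊔ Subfunctor.ofSection y)) :
    I.rlp.llp (Subfunctor.homOfLe hX) := by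
  intro E B p hp
  refine ⟨fun {a b} sq => ?_⟩
  let PE : ClosedDendroidalSet :=
    { obj := fun U => Y.obj U × E.obj U
      map := fun g => TypeCat.ofHom fun x => (Y.map g x.1, E.map g x.2) }
  let π : PE ⟶ Y := { app := fun U => TypeCat.ofHom fun x => x.1 }
  have hw : ∀ U (x : X.toFunctor.obj U), p.app U (a.app U x) = b.app U ⟨x.1, hX U x.2⟩ :=
    fun U x => types_congr_hom (congr_app sq.w U) x
  -- A partial lift is encoded by its graph in `Y × E`, and its domain is the image under `π`.
  -- Unions of chains of graphs are graphs, so no transfinite composition has to be built.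
  let Good : Subfunctor PE → Prop := fun G =>
    (∀ U y e e', (y, e) ∈ G.obj U → (y, e') ∈ G.obj U → e = e') ∧
    (∀ U y e, (y, e) ∈ G.obj U → ∃ h : y ∈ X'.obj U, p.app U e = b.app U ⟨y, h⟩) ∧
    (∀ U (x : X.toFunctor.obj U), (x.1, a.app U x) ∈ G.obj U) ∧
    C (G.image π)
  let G₀ : Subfunctor PE :=
    { obj := fun U => Set.range fun x : X.toFunctor.obj U => (x.1, a.app U x)
      map := by
        rintro U V g _ ⟨x, rfl⟩
        exact ⟨X.toFunctor.map g x, Prod.ext rfl (NatTrans.naturality_apply a g x)⟩ }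
  have himage : ∀ (G : Subfunctor PE) U y, y ∈ (G.image π).obj U ↔ ∃ e, (y, e) ∈ G.obj U := by
    intro G U y
    constructor
    · rintro ⟨⟨y, e⟩, h, rfl⟩
      exact ⟨e, h⟩
    · rintro ⟨e, h⟩
      exact ⟨(y, e), h, rfl⟩
  have hG₀ : Good G₀ := by
    refine ⟨?_, ?_, fun U x => ⟨x, rfl⟩, ?_⟩
    · rintro U y e e' ⟨x, hx⟩ ⟨x', hx'⟩
      obtain ⟨rfl, rfl⟩ := Prod.ext_iff.1 hx
      obtain ⟨h, rfl⟩ := Prod.ext_iff.1 hx'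
      obtain rfl : x' = x := Subtype.ext h
      rfl
    · rintro U y e ⟨x, hx⟩
      obtain ⟨rfl, rfl⟩ := Prod.ext_iff.1 hx
      exact ⟨hX U x.2, hw U x⟩
    · convert hCX using 1
      ext U y
      rw [himage]
      refine ⟨fun ⟨e, x, hx⟩ => ?_, fun h => ⟨_, ⟨y, h⟩, rfl⟩⟩
      obtain rfl := (Prod.ext_iff.1 hx).1
      exact x.2
  have hchain : ∀ c ⊆ {G | Good G}, IsChain (· ≤ ·) c → ∀ G ∈ c,
      ∃ ub ∈ {G | Good G}, ∀ z ∈ c, z ≤ ub := by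
    intro c hc hch G hG
    have hmem : ∀ U z, z ∈ (sSup c).obj U ↔ ∃ G ∈ c, z ∈ G.obj U := by
      intro U z
      simp [Subfunctor.sSup_obj]
    refine ⟨sSup c, ⟨?_, ?_, fun U x => (hmem _ _).2 ⟨G, hG, (hc hG).2.2.1 U x⟩, ?_⟩,
      fun z hz => le_sSup hz⟩
    · intro U y e e' he he'
      obtain ⟨G₁, hG₁, he⟩ := (hmem _ _).1 he
      obtain ⟨G₂, hG₂, he'⟩ := (hmem _ _).1 he'
      rcases hch.total hG₁ hG₂ with h | h
      · exact (hc hG₂).1 U y e e' (h U he) he'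
      · exact (hc hG₁).1 U y e e' he (h U he')
    · intro U y e he
      obtain ⟨G₁, hG₁, he⟩ := (hmem _ _).1 he
      exact (hc hG₁).2.1 U y e he
    · have : (sSup c).image π = sSup ((fun G => G.image π) '' c) := by
        ext U y
        rw [himage]
        simp only [Subfunctor.sSup_obj, Set.sSup_eq_sUnion, Set.mem_sUnion, Set.mem_image,
          exists_exists_and_eq_and]
        constructor
        · rintro ⟨e, he⟩
          obtain ⟨G, hG, h⟩ := he
          exact ⟨G, hG, (himage G U y).2 ⟨e, h⟩⟩
        · rintro ⟨G, hG, h⟩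
          obtain ⟨e, h⟩ := (himage G U y).1 h
          exact ⟨e, G, hG, h⟩
      rw [this]
      refine hC _ ⟨_, G, hG, rfl⟩ ?_
      rintro _ ⟨G, hG, rfl⟩
      exact (hc hG).2.2.2
  obtain ⟨G, -, hG, hmax⟩ := zorn_le_nonempty₀ {G | Good G} hchain G₀ hG₀
  obtain ⟨hG1, hG2, hG3, hG4⟩ := hG
  have hGX : X ≤ G.image π := fun U y hy => (himage G U y).2 ⟨_, hG3 U ⟨y, hy⟩⟩
  have hGX' : G.image π ≤ X' := by
    intro U y hy
    obtain ⟨e, he⟩ := (himage G U y).1 hy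
    exact (hG2 U y e he).1
  by_cases htop : G.image π = X'
  · have hex : ∀ U (y : X'.toFunctor.obj U), ∃ e, (y.1, e) ∈ G.obj U := by
      intro U y
      rw [← himage, htop]
      exact y.2
    choose φ hφ using hex
    refine ⟨⟨⟨{ app := fun U => TypeCat.ofHom (φ U), naturality := ?_ }, ?_, ?_⟩⟩⟩
    · intro U V g
      ext y
      exact hG1 V _ _ _ (hφ V _) (G.map g (hφ U y))
    · ext U x
      exact hG1 U _ _ _ (hφ U _) (hG3 U x)
    · ext U y
      exact (hG2 U _ _ (hφ U y)).2
  -- On a proper domain one more cell is available. Restricting `G` to `K` gives a lifting problem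
  -- of `K.ι` against `p`, and adjoining the solution enlarges the maximal graph.
  · exfalso
    obtain ⟨S, y, K, hK, hyX', hyZ, hiff, hinj, hCZ⟩ := step _ hGX hGX' hG4 htop
    have hex : ∀ U (g : K.toFunctor.obj U), ∃ e, (Y.map g.1.op y, e) ∈ G.obj U := by
      intro U g
      rw [← himage]
      exact (hiff U.unop g.1).1 g.2
    choose φ hφ using hex
    have hφG : ∀ {U V : ClosedTreeᵒᵖ} (h : U ⟶ V) (g : K.toFunctor.obj U),
        (Y.map (h.unop ≫ g.1).op y, E.map h (φ U g)) ∈ G.obj V := by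
      intro U V h g
      have := G.map h (hφ U g)
      rw [op_comp, Functor.map_comp, types_comp_apply]
      exact this
    let k : K.toFunctor ⟶ E :=
      { app := fun U => TypeCat.ofHom (φ U)
        naturality := by
          intro U V h
          ext g
          exact hG1 V _ _ _ (hφ V _) (hφG h g) }
    let bY : yoneda.obj S ⟶ B := yonedaEquiv.symm (b.app (op S) ⟨y, hyX'⟩)
    have hbY : ∀ (R : ClosedTree) (g : R ⟶ S),
        bY.app (op R) g = b.app (op R) ⟨Y.map g.op y, X'.map g.op hyX'⟩ := by
      intro R g
      exact (NatTrans.naturality_apply b g.op (⟨y, hyX'⟩ : X'.toFunctor.obj (op S))).symm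
    have hsq : CommSq k K.ι p bY := ⟨by
      ext U g
      refine (hG2 U _ _ (hφ U g)).2.trans ?_
      exact (hbY U.unop g.1).symm⟩
    have := hp K.ι hK
    let L := hsq.lift
    let e₀ : E.obj (op S) := L.app (op S) (𝟙 S)
    have hL : ∀ (R : ClosedTree) (g : R ⟶ S), E.map g.op e₀ = L.app (op R) g := by
      intro R g
      refine (NatTrans.naturality_apply L g.op (𝟙 S)).symm.trans ?_
      exact congrArg (L.app (op R)) (Category.comp_id g)
    have hLK : ∀ (R : ClosedTree) (g : R ⟶ S), g ∈ K.obj (op R) →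
        (Y.map g.op y, E.map g.op e₀) ∈ G.obj (op R) := by
      intro R g hg
      rw [hL]
      have := types_congr_hom (congr_app hsq.fac_left (op R)) ⟨g, hg⟩
      have h2 : L.app (op R) g = φ (op R) ⟨g, hg⟩ := this
      rw [h2]
      exact hφ (op R) ⟨g, hg⟩
    have hLp : ∀ (R : ClosedTree) (g : R ⟶ S), p.app (op R) (E.map g.op e₀) =
        b.app (op R) ⟨Y.map g.op y, X'.map g.op hyX'⟩ := by
      intro R g
      rw [hL, ← hbY]
      exact types_congr_hom (congr_app hsq.fac_right (op R)) g
    let z₀ : PE.obj (op S) := (y, e₀)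
    have hz₀ : ∀ (R : ClosedTreeᵒᵖ) z, z ∈ (Subfunctor.ofSection z₀).obj R ↔
        ∃ g : R.unop ⟶ S, z = (Y.map g.op y, E.map g.op e₀) := by
      intro R z
      constructor
      · rintro ⟨g, rfl⟩
        exact ⟨g.unop, rfl⟩
      · rintro ⟨g, rfl⟩
        exact ⟨g.op, rfl⟩
    have hgood : Good (G ⊔ Subfunctor.ofSection z₀) := by
      have hmix : ∀ U y' e e', (y', e) ∈ G.obj U → (y', e') ∈ (Subfunctor.ofSection z₀).obj U →
          (y', e') ∈ G.obj U := by
        intro U y' e e' he he'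
        obtain ⟨g, hg⟩ := (hz₀ U _).1 he'
        obtain ⟨rfl, rfl⟩ := Prod.ext_iff.1 hg
        exact hLK _ g ((hiff _ g).2 ((himage _ _ _).2 ⟨e, he⟩))
      refine ⟨?_, ?_, fun U x => Or.inl (hG3 U x), ?_⟩
      · rintro U y' e e' (he | he) (he' | he')
        · exact hG1 U _ _ _ he he'
        · exact hG1 U _ _ _ he (hmix U _ _ _ he he')
        · exact hG1 U _ _ _ (hmix U _ _ _ he' he) he'
        · obtain ⟨g, hg⟩ := (hz₀ U _).1 he
          obtain ⟨g', hg'⟩ := (hz₀ U _).1 he'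
          obtain ⟨rfl, rfl⟩ := Prod.ext_iff.1 hg
          obtain ⟨h1, rfl⟩ := Prod.ext_iff.1 hg'
          dsimp only at h1
          -- A section of the cell may arise from two morphisms. They lie in `K` simultaneously:
          -- inside `K` the value is dictated by `G`, and outside `K` the two morphisms coincide.
          have hgg : g ∈ K.obj U ↔ g' ∈ K.obj U := by
            rw [hiff U.unop g, hiff U.unop g', h1]
          by_cases hgK : g ∈ K.obj U
          · have h2 := hLK _ g hgK
            rw [h1] at h2
            exact hG1 U _ _ _ h2 (hLK _ g' (hgg.1 hgK))
          · rw [hinj _ g g' hgK (fun h => hgK (hgg.2 h)) h1]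
      · rintro U y' e (he | he)
        · exact hG2 U _ _ he
        · obtain ⟨g, hg⟩ := (hz₀ U _).1 he
          obtain ⟨rfl, rfl⟩ := Prod.ext_iff.1 hg
          exact ⟨_, hLp _ g⟩
      · convert hCZ using 1
        ext U y'
        rw [himage]
        constructor
        · rintro ⟨e, he | he⟩
          · exact Or.inl ((himage _ _ _).2 ⟨e, he⟩)
          · obtain ⟨g, hg⟩ := (hz₀ U _).1 he
            obtain ⟨rfl, rfl⟩ := Prod.ext_iff.1 hg
            exact Or.inr ⟨g.op, rfl⟩
        · rintro (h | ⟨g, rfl⟩)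
          · obtain ⟨e, he⟩ := (himage _ _ _).1 h
            exact ⟨e, Or.inl he⟩
          · exact ⟨E.map g e₀, Or.inr ((hz₀ U _).2 ⟨g.unop, rfl⟩)⟩
    have hle := hmax hgood le_sup_left
    exact hyZ ((himage _ _ _).2 ⟨e₀, hle _ (Or.inr (Subfunctor.mem_ofSection_obj z₀))⟩)

open Opposite Limits MorphismProperty MonoidalCategory ClosedTree

/-! ### The small object argument for very inner horns -/

lemma veryInnerHornInclusion_eq_ofHoms :
    VeryInnerHornInclusion = MorphismProperty.ofHoms
      (fun i : Σ T : ClosedTree, {e : T.obj.Edge // T.obj.IsVeryInner e} =>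
        (horn i.1 i.2.1).ι) := by
  ext A B f
  rw [MorphismProperty.ofHoms_iff]
  constructor
  · rintro ⟨T, e, he⟩
    exact ⟨⟨T, e, he⟩, rfl⟩
  · rintro ⟨i, hi⟩
    obtain ⟨T, e, he⟩ := i
    exact (MorphismProperty.arrow_mk_mem_toSet_iff _ _).1
      (hi ▸ VeryInnerHornInclusion.mk T e he)

instance : MorphismProperty.IsSmall.{0} VeryInnerHornInclusion := by
  rw [veryInnerHornInclusion_eq_ofHoms]
  exact isSmall_ofHoms ..

instance : HasSmallObjectArgument.{0} VeryInnerHornInclusion := by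
  let ι := Σ T : ClosedTree, {e : T.obj.Edge // T.obj.IsVeryInner e}
  have h (i : ι) : IsPresentable.{0} (horn i.1 i.2.1).toFunctor := inferInstance
  choose κ₀ hκ₀ h using fun i => (h i).exists_cardinal
  -- The horns form a small family, so one regular cardinal bounds the presentability ranks of all
  -- of them.
  obtain ⟨κ, hκ, hlt⟩ := HasCardinalLT.exists_regular_cardinal_forall.{0}
    (fun i => (κ₀ i).ord.ToType)
  have : Fact κ.IsRegular := ⟨hκ⟩
  have : Nonempty κ.ord.ToType := by simpa using hκ.ne_zero
  have := WellFoundedLT.toOrderBot κ.ord.ToType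
  refine ⟨κ, inferInstance, inferInstance, { preservesColimit := ?_ }⟩
  rintro A B X Y i ⟨T, e, he⟩ f hf
  have hle : κ₀ ⟨T, e, he⟩ ≤ κ := by
    have := hlt ⟨T, e, he⟩
    rw [hasCardinalLT_iff_cardinal_mk_lt] at this
    simpa using this.le
  have : IsCardinalPresentable (horn T e).toFunctor (κ₀ ⟨T, e, he⟩) := h ⟨T, e, he⟩
  have := isCardinalPresentable_of_le (horn T e).toFunctor hle
  have := preservesColimitsOfShape_of_isCardinalPresentable (horn T e).toFunctor κ κ.ord.ToType
  infer_instance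

lemma isSaturated_llp (W : MorphismProperty ClosedDendroidalSet) : IsSaturated W.llp where
  pushouts := inferInstance
  coproducts := inferInstance
  transfinite := inferInstance
  retracts := inferInstance

lemma via_eq_llp_rlp : via = VeryInnerHornInclusion.rlp.llp := by
  apply le_antisymm
  · intro A B f hf
    exact hf _ (isSaturated_llp _) (le_llp_rlp _)
  · intro A B f hf W hW hI
    have := hW.pushouts
    have := hW.coproducts
    have := hW.transfinite
    have := hW.retracts
    rw [llp_rlp_of_hasSmallObjectArgument] at hf
    have h1 : (coproducts.{0} VeryInnerHornInclusion).pushouts ≤ W := by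
      rw [pushouts_le_iff, coproducts_le_iff]
      exact hI
    have h2 : transfiniteCompositions.{0} (coproducts.{0} VeryInnerHornInclusion).pushouts ≤ W :=
      (transfiniteCompositions_monotone h1).trans (transfiniteCompositions_le W)
    have h3 := (retracts_le_iff).2 h2
    exact h3 _ hf

lemma isSaturated_via : IsSaturated via := by
  rw [via_eq_llp_rlp]
  exact isSaturated_llp _

lemma veryInnerHornInclusion_le_via : VeryInnerHornInclusion ≤ via := by
  rw [via_eq_llp_rlp]
  exact le_llp_rlp _

/-! ### Labelled sections and marked edges -/

/-- The closed dendroidal set of labelings of the edges of closed trees by `true` and `false`; it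
plays the role of the nerve of the contractible groupoid on two objects. -/
def labelings : ClosedDendroidalSet where
  obj U := U.unop.obj.Edge → Bool
  map g := TypeCat.ofHom fun φ x => φ (fn g.unop x)

/-- The map on edges together with the labels, for a section of `labelings ⊗ yoneda.obj T`. -/
def label {S T : ClosedTree} (y : (labelings ⊗ yoneda.obj T : ClosedDendroidalSet).obj (op S))
    (s : S.obj.Edge) : T.obj.Edge × Bool :=
  (fn (show S ⟶ T from y.2) s, (show S.obj.Edge → Bool from y.1) s)

section

variable {R S T : ClosedTree} (y : (labelings ⊗ yoneda.obj T : ClosedDendroidalSet).obj (op S))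

lemma label_map (g : R ⟶ S) (r : R.obj.Edge) :
    label ((labelings ⊗ yoneda.obj T : ClosedDendroidalSet).map g.op y) r = label y (fn g r) := rfl

lemma range_label_map (g : R ⟶ S) :
    Set.range (label ((labelings ⊗ yoneda.obj T : ClosedDendroidalSet).map g.op y)) ⊆
      Set.range (label y) := by
  rintro _ ⟨r, rfl⟩
  exact ⟨_, (label_map y g r).symm⟩

variable {y}

lemma label_ext {y' : (labelings ⊗ yoneda.obj T : ClosedDendroidalSet).obj (op S)}
    (h : ∀ s, label y s = label y' s) : y = y' :=
  Prod.ext (funext fun s => (Prod.ext_iff.1 (h s)).2)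
    (ClosedTree.hom_ext fun s => (Prod.ext_iff.1 (h s)).1)

end

/-- The sections of `labelings ⊗ yoneda.obj T` such that the set of values of `label` satisfies a
given predicate. -/
def labelSub (T : ClosedTree) (P : Set (T.obj.Edge × Bool) → Prop)
    (hP : ∀ ρ ρ', ρ ⊆ ρ' → P ρ' → P ρ) :
    Subfunctor (labelings ⊗ yoneda.obj T : ClosedDendroidalSet) where
  obj U := {y | P (Set.range (label (S := U.unop) y))}
  map := by
    intro U V g y hy
    exact hP _ _ (range_label_map (S := U.unop) (R := V.unop) y g.unop) hy

lemma mem_labelSub {T : ClosedTree} {P : Set (T.obj.Edge × Bool) → Prop}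
    {hP : ∀ ρ ρ', ρ ⊆ ρ' → P ρ' → P ρ} {S : ClosedTree}
    {y : (labelings ⊗ yoneda.obj T : ClosedDendroidalSet).obj (op S)} :
    y ∈ (labelSub T P hP).obj (op S) ↔ P (Set.range (label y)) := Iff.rfl

/-- The edge `ε` is sent to `a` with label `q`, and it is the topmost or the lowest edge above `a`,
depending on `Lo a`. -/
structure IsMarked {S T : ClosedTree} (a : T.obj.Edge) (q : Bool) (Lo : T.obj.Edge → Prop)
    (y : (labelings ⊗ yoneda.obj T : ClosedDendroidalSet).obj (op S)) (ε : S.obj.Edge) : Prop where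
  label_eq : label y ε = (a, q)
  lt : ∀ s, s ≠ ε → (label y s).1 = a → Lo a → s < ε
  gt : ∀ s, s ≠ ε → (label y s).1 = a → ¬ Lo a → ε < s

section

variable {S T : ClosedTree} {a : T.obj.Edge} {q : Bool} {Lo : T.obj.Edge → Prop}
  {y : (labelings ⊗ yoneda.obj T : ClosedDendroidalSet).obj (op S)} {ε : S.obj.Edge}

lemma IsMarked.fn_eq (h : IsMarked a q Lo y ε) : fn (show S ⟶ T from y.2) ε = a :=
  (Prod.ext_iff.1 h.label_eq).1

lemma IsMarked.map (h : IsMarked a q Lo y ε) {R : ClosedTree} (i : R ⟶ S)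
    {ε' : R.obj.Edge} (hε : fn i ε' = ε) (hi : Function.Injective (fn i)) :
    IsMarked a q Lo ((labelings ⊗ yoneda.obj T : ClosedDendroidalSet).map i.op y) ε' where
  label_eq := by rw [label_map, hε, h.label_eq]
  lt s hs hsa hL := lt_of_fn_lt i <| by
    rw [hε]
    exact h.lt _ (fun h => hs (hi (h.trans hε.symm))) hsa hL
  gt s hs hsa hL := lt_of_fn_lt i <| by
    rw [hε]
    exact h.gt _ (fun h => hs (hi (h.trans hε.symm))) hsa hL

lemma IsMarked.isVeryInner (h : IsMarked a q Lo y ε) (hLo : ∀ t, Lo t → t ≤ a)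
    (h1 : ∃ z ∈ Set.range (label y), z ≠ (a, q) ∧ Lo z.1)
    (h2 : ∃ z ∈ Set.range (label y), z ≠ (a, q) ∧ a ≤ z.1 ∧ ¬ Lo z.1) :
    S.obj.IsVeryInner ε := by
  rw [isVeryInner_iff]
  constructor
  · rintro rfl
    obtain ⟨_, ⟨s, rfl⟩, hs, hs'⟩ := h1
    have hne : s ≠ S.obj.rootEdge := fun h' => hs (h' ▸ h.label_eq)
    rcases (hLo _ hs').eq_or_lt with h3 | h3
    · exact (h.lt s hne h3 (h3 ▸ hs')).not_ge (S.obj.rootEdge_le s)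
    · refine (lt_of_fn_lt (show S ⟶ T from y.2) ?_).not_ge (S.obj.rootEdge_le s)
      rw [h.fn_eq]
      exact h3
  · obtain ⟨_, ⟨s, rfl⟩, hs, hs', hs''⟩ := h2
    refine ⟨s, ?_⟩
    have hne : s ≠ ε := fun h' => hs (h' ▸ h.label_eq)
    rcases hs'.eq_or_lt with h3 | h3
    · exact h.gt s hne h3.symm (fun h4 => hs'' (h3 ▸ h4))
    · refine lt_of_fn_lt (show S ⟶ T from y.2) ?_
      rw [h.fn_eq]
      exact h3

end

/-- A new marked edge can be inserted. -/
lemma exists_insert {S T : ClosedTree} (a : T.obj.Edge) (q : Bool) (Lo : T.obj.Edge → Prop)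
    (hLo : ∀ t, Lo t → t ≤ a) (hLo' : ∀ t, t < a → Lo t)
    (y : (labelings ⊗ yoneda.obj T : ClosedDendroidalSet).obj (op S))
    (h : ∃ z ∈ Set.range (label y), Lo z.1) :
    ∃ (S' : ClosedTree) (y' : (labelings ⊗ yoneda.obj T : ClosedDendroidalSet).obj (op S'))
      (ε : S'.obj.Edge) (i : S ⟶ S'), IsMarked a q Lo y' ε ∧
      (labelings ⊗ yoneda.obj T : ClosedDendroidalSet).map i.op y' = y ∧
      Set.range (label y') = insert (a, q) (Set.range (label y)) := by
  let f : S ⟶ T := y.2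
  have hdown : ∀ t t', t ≤ t' → Lo t' → Lo t := by
    intro t t' htt' ht'
    rcases htt'.eq_or_lt with h | h
    · exact h ▸ ht'
    · exact hLo' _ (h.trans_le (hLo _ ht'))
  -- Here `none` is the new edge. It is placed above all edges over `Lo` and below all edges over
  -- the rest of the part of `T` above `a`.
  let le : Option S.obj.Edge → Option S.obj.Edge → Prop := fun x x' =>
    match x, x' with
    | some s, some s' => s ≤ s'
    | some s, none => Lo (fn f s)
    | none, some s => a ≤ fn f s ∧ ¬ Lo (fn f s)
    | none, none => True
  have hcase : ∀ s s' : S.obj.Edge, Lo (fn f s) → a ≤ fn f s' → ¬ Lo (fn f s') → s < s' := by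
    intro s s' h1 h2 h3
    refine lt_of_fn_lt f (lt_of_le_of_ne ((hLo _ h1).trans h2) ?_)
    intro h4
    exact h3 (h4 ▸ h1)
  obtain ⟨S', e, he⟩ := exists_equiv (Option S.obj.Edge) le
    (by rintro (_ | s); exacts [trivial, le_refl s])
    (by
      rintro (_ | s) (_ | s') (_ | s'') h1 h2
      · trivial
      · exact h2
      · trivial
      · exact ⟨h1.1.trans (fn_mono f h2), fun h3 => h1.2 (hdown _ _ (fn_mono f h2) h3)⟩
      · exact h1
      · exact (hcase _ _ h1 h2.1 h2.2).le
      · exact hdown _ _ (fn_mono f h1) h2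
      · exact le_trans (α := S.obj.Edge) h1 h2)
    (by
      rintro (_ | s) (_ | s') h1 h2
      · rfl
      · exact absurd h2 h1.2
      · exact absurd h1 h2.2
      · exact congrArg some (le_antisymm (α := S.obj.Edge) h1 h2))
    (some S.obj.rootEdge)
    (by
      rintro (_ | s)
      · obtain ⟨_, ⟨s, rfl⟩, hs⟩ := h
        exact hdown _ _ (fn_mono f (S.obj.rootEdge_le s)) hs
      · exact S.obj.rootEdge_le s)
    (by
      rintro (_ | s) (_ | s') (_ | s'') h1 h2
      · exact Or.inl trivial
      · exact Or.inl trivial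
      · exact Or.inr h2
      · by_cases h3 : Lo (fn f s')
        · exact Or.inr h3
        · refine Or.inl ⟨?_, h3⟩
          rcases Tree.le_or_le_of_le h1.1 (fn_mono f h2) with h4 | h4
          · exact h4
          · rcases h4.eq_or_lt with h5 | h5
            · exact h5.ge
            · exact absurd (hLo' _ h5) h3
      · exact Or.inl h1
      · by_cases h3 : Lo (fn f s)
        · exact Or.inl h3
        · refine Or.inr ⟨?_, h3⟩
          rcases Tree.le_or_le_of_le h2.1 (fn_mono f h1) with h4 | h4
          · exact h4
          · rcases h4.eq_or_lt with h5 | h5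
            · exact h5.ge
            · exact absurd (hLo' _ h5) h3
      · rcases Tree.le_or_le_of_le (hLo _ h1) (hLo _ h2) with h3 | h3
        · exact comparable_of_fn_le f h3
        · exact (comparable_of_fn_le f h3).symm
      · exact Tree.le_or_le_of_le (T := S.obj) h1 h2)
  let φ : Option S.obj.Edge → T.obj.Edge := fun x => x.elim a (fn f)
  let f' : S' ⟶ T := ofFn (fun x => φ (e x))
    (by
      intro x x' hx
      have hx' := (he _ _).1 hx
      generalize e x = u at hx'
      generalize e x' = u' at hx'
      rcases u with _ | s <;> rcases u' with _ | s'
      · exact le_rfl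
      · exact hx'.1
      · exact hLo _ hx'
      · exact fn_mono f hx')
    (by
      intro x x' hx
      rw [he, he]
      generalize e x = u at hx
      generalize e x' = u' at hx
      rcases u with _ | s <;> rcases u' with _ | s'
      · exact Or.inl trivial
      · by_cases h3 : Lo (fn f s')
        · exact Or.inr h3
        · exact Or.inl ⟨hx, h3⟩
      · by_cases h3 : Lo (fn f s)
        · exact Or.inl h3
        · refine Or.inr ⟨?_, h3⟩
          rcases (show fn f s ≤ a from hx).eq_or_lt with h4 | h4
          · exact h4.ge
          · exact absurd (hLo' _ h4) h3
      · exact comparable_of_fn_le f hx)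
  let i : S ⟶ S' := ofFn (fun s => e.symm (some s))
    (fun s s' hs => by rw [he]; simpa using hs) (fun s s' hs => by rw [he] at hs; simpa using Or.inl hs)
  let y' : (labelings ⊗ yoneda.obj T : ClosedDendroidalSet).obj (op S') :=
    (fun x => (e x).elim q y.1, f')
  have hlab : ∀ x, label y' x = (e x).elim (a, q) (label y) := by
    intro x
    have : label y' x = (φ (e x), (e x).elim q y.1) := rfl
    rw [this]
    rcases e x with _ | s <;> rfl
  refine ⟨S', y', e.symm none, i, ⟨?_, ?_, ?_⟩, ?_, ?_⟩
  · rw [hlab]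
    simp
  · intro x hx hxa hL
    rw [← e.symm_apply_apply x] at hx ⊢
    rw [hlab] at hxa
    rcases hex : e x with _ | s
    · rw [hex] at hx
      exact absurd rfl hx
    · rw [hex] at hxa
      refine lt_of_le_of_ne ((he _ _).2 ?_) (by simp)
      simp only [Equiv.apply_symm_apply]
      have hxa' : fn f s = a := hxa
      exact (show Lo (fn f s) by rwa [hxa'])
  · intro x hx hxa hL
    rw [← e.symm_apply_apply x] at hx ⊢
    rw [hlab] at hxa
    rcases hex : e x with _ | s
    · rw [hex] at hx
      exact absurd rfl hx
    · rw [hex] at hxa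
      have hxa' : fn f s = a := hxa
      refine lt_of_le_of_ne ((he _ _).2 ?_) (by simp)
      simp only [Equiv.apply_symm_apply]
      exact ⟨hxa'.ge, by rwa [hxa']⟩
  · apply label_ext
    intro s
    rw [label_map, hlab]
    simp [i]
  · ext z
    constructor
    · rintro ⟨x, rfl⟩
      rw [hlab]
      rcases e x with _ | s
      · exact Or.inl rfl
      · exact Or.inr ⟨s, rfl⟩
    · rintro (rfl | ⟨s, rfl⟩)
      · exact ⟨e.symm none, by rw [hlab]; simp⟩
      · exact ⟨e.symm (some s), by rw [hlab]; simp⟩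

section

variable {S T : ClosedTree} {a : T.obj.Edge} {q : Bool} {Lo : T.obj.Edge → Prop}
  {y : (labelings ⊗ yoneda.obj T : ClosedDendroidalSet).obj (op S)} {ε : S.obj.Edge}

/-- If two comparable edges of a section have the same label and no other edge, except possibly
a marked one, lies between them, then the section is degenerate. -/
lemma IsMarked.exists_collapse (h : IsMarked a q Lo y ε) {s s' : S.obj.Edge} (hs : s < s')
    (hy : label y s = label y s') (hno : ∀ t, t ≠ ε → s < t → ¬ t < s') :
    ∃ u : S ⟶ S, (labelings ⊗ yoneda.obj T : ClosedDendroidalSet).map u.op y = y ∧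
      ∃ d, d ≠ ε ∧ d ∉ Set.range (fn u) := by
  classical
  let f : S ⟶ T := y.2
  have hfs : fn f s = fn f s' := (Prod.ext_iff.1 hy).1
  -- The marked edge cannot lie in between either: `s` and `s'` would then both lie over `a`, on
  -- either side of an edge that is extremal there.
  have hcov : ∀ t, s < t → ¬ t < s' := by
    intro t h1 h2
    by_cases ht : t = ε
    · subst ht
      have h3 : fn f s = a := by
        apply le_antisymm
        · rw [← h.fn_eq]
          exact fn_mono f h1.le
        · rw [← h.fn_eq, hfs]
          exact fn_mono f h2.le
      have h4 : fn f s' = a := hfs.symm.trans h3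
      by_cases hL : Lo a
      · exact (h.lt s' h2.ne' h4 hL).not_gt h2
      · exact (h.gt s h1.ne h3 hL).not_gt h1
    · exact hno t ht h1 h2
  have key : ∀ φ : S.obj.Edge → S.obj.Edge, (∀ r, label y (φ r) = label y r) →
      (∀ a b, a ≤ b → fn f a = fn f b → φ a ≤ φ b) → (∃ d, d ≠ ε ∧ ∀ r, φ r ≠ d) →
      ∃ u : S ⟶ S, (labelings ⊗ yoneda.obj T : ClosedDendroidalSet).map u.op y = y ∧
        ∃ d, d ≠ ε ∧ d ∉ Set.range (fn u) := by
    rintro φ h1 h2 ⟨d, hd, hd'⟩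
    obtain ⟨u, -, hu⟩ := exists_hom_of_comp f f φ (fun r => (Prod.ext_iff.1 (h1 r)).1) h2
    refine ⟨u, label_ext fun r => ?_, d, hd, ?_⟩
    · rw [label_map, hu, h1]
    · rintro ⟨r, hr⟩
      exact hd' r (by rw [← hu, hr])
  -- The two edges are merged by dropping one that is not `ε`, so that the endomorphism misses an
  -- edge other than `ε`.
  by_cases hs' : s' = ε
  · refine key (Function.update id s s') ?_ ?_ ⟨s, fun h => hs.ne (h.trans hs'.symm), ?_⟩
    · intro r
      by_cases hr : r = s
      · subst hr
        simp [hy]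
      · simp [hr]
    · intro b c hbc hfbc
      by_cases hb : b = s
      · subst hb
        by_cases hc : c = b
        · simp [hc]
        · simp only [Function.update_self, Function.update_of_ne hc, id]
          rcases comparable_of_fn_le f (hfs.symm.trans hfbc).le with h1 | h1
          · exact h1
          · rcases h1.eq_or_lt with h2 | h2
            · exact h2.ge
            · exact absurd h2 (hcov c (lt_of_le_of_ne hbc (Ne.symm hc)))
      · by_cases hc : c = s
        · subst hc
          simpa [Function.update_of_ne hb] using hbc.trans hs.le
        · simpa [Function.update_of_ne hb, Function.update_of_ne hc] using hbc
    · intro r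
      by_cases hr : r = s
      · subst hr
        simp [hs.ne']
      · simp [hr]
  · refine key (Function.update id s' s) ?_ ?_ ⟨s', hs', ?_⟩
    · intro r
      by_cases hr : r = s'
      · subst hr
        simp [hy]
      · simp [hr]
    · intro b c hbc hfbc
      by_cases hc : c = s'
      · subst hc
        by_cases hb : b = c
        · simp [hb]
        · simp only [Function.update_self, Function.update_of_ne hb, id]
          rcases comparable_of_fn_le f (hfbc.trans hfs.symm).le with h1 | h1
          · exact h1
          · rcases h1.eq_or_lt with h2 | h2
            · exact h2.ge
            · exact absurd (lt_of_le_of_ne hbc hb) (hcov b h2)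
      · by_cases hb : b = s'
        · subst hb
          simpa [Function.update_of_ne hc] using hs.le.trans hbc
        · simpa [Function.update_of_ne hb, Function.update_of_ne hc] using hbc
    · intro r
      by_cases hr : r = s'
      · subst hr
        simp [hs.ne]
      · simp [hr]

/-- Sections of a nondegenerate marked section are determined by their labels. -/
lemma IsMarked.hom_ext {R : ClosedTree} {g g' : R ⟶ S}
    (hgap : ∀ s s' : S.obj.Edge, s < s' → label y s = label y s' → ∃ t, t ≠ ε ∧ s < t ∧ t < s')
    (hg : {ε}ᶜ ⊆ Set.range (fn g)) (hg' : {ε}ᶜ ⊆ Set.range (fn g'))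
    (hgg : ∀ r, label y (fn g r) = label y (fn g' r)) : g = g' := by
  let f : S ⟶ T := y.2
  have key : ∀ g g' : R ⟶ S, {ε}ᶜ ⊆ Set.range (fn g') →
      (∀ r, label y (fn g r) = label y (fn g' r)) → ∀ r, (∀ r' < r, fn g r' = fn g' r') →
      ¬ fn g r < fn g' r := by
    intro g g' hg' hgg r hr hlt
    -- The intermediate edge `t` is `g' r'` with `r' < r`, hence also `g r'` because the maps agree
    -- below `r`. But `t` lies strictly above `g r`, against monotonicity of `g`.
    obtain ⟨t, ht, h1, h2⟩ := hgap _ _ hlt (hgg r)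
    obtain ⟨r', rfl⟩ := hg' ht
    have h3 := lt_of_fn_lt g' h2
    rw [← hr r' h3] at h1
    exact h1.not_ge (fn_mono g h3.le)
  apply ClosedTree.hom_ext
  intro r
  induction r using (wellFounded_lt (α := R.obj.Edge)).induction with
  | _ r ih =>
    have h1 : fn f (fn g r) = fn f (fn g' r) := (Prod.ext_iff.1 (hgg r)).1
    have h2 := key g g' hg' hgg r ih
    have h3 := key g' g hg (fun r => (hgg r).symm) r (fun r' hr' => (ih r' hr').symm)
    rcases comparable_of_fn_le f h1.le with h4 | h4
    · exact h4.eq_of_not_lt h2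
    · exact (h4.eq_of_not_lt h3).symm

/-- Marked sections are compatible with factorizations through the face omitting the marked
edge. -/
lemma IsMarked.exists_extension {S' R : ClosedTree}
    {y' : (labelings ⊗ yoneda.obj T : ClosedDendroidalSet).obj (op S')} {ε' : S'.obj.Edge}
    (h : IsMarked a q Lo y ε) (h' : IsMarked a q Lo y' ε') (i : R ⟶ S') (g : R ⟶ S)
    (hi : {ε'}ᶜ ⊆ Set.range (fn i)) (hig : ∀ r, label y (fn g r) = label y' (fn i r)) :
    ∃ g' : S' ⟶ S, (labelings ⊗ yoneda.obj T : ClosedDendroidalSet).map g'.op y = y' := by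
  classical
  have hc : ∀ s, s ≠ ε' → ∃ r, fn i r = s := fun s hs => hi hs
  have : Nonempty R.obj.Edge := ⟨R.obj.rootEdge⟩
  choose! c hc using hc
  let f : S ⟶ T := y.2
  let f' : S' ⟶ T := y'.2
  -- Marked goes to marked. Both marked edges are extremal on the same side over `a`, which makes
  -- this monotone on the fibre of `a`.
  let φ : S'.obj.Edge → S.obj.Edge := fun s => if s = ε' then ε else fn g (c s)
  have hφ : ∀ s, label y (φ s) = label y' s := by
    intro s
    by_cases hs : s = ε'
    · simp only [φ, hs, if_true, h.label_eq, h'.label_eq]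
    · simp only [φ, hs, if_false, hig, hc s hs]
  obtain ⟨u, -, hu⟩ := exists_hom_of_comp f f' φ (fun s => (Prod.ext_iff.1 (hφ s)).1) (by
    intro b b' hbb hf
    by_cases hb : b = ε' <;> by_cases hb' : b' = ε'
    · simp [φ, hb, hb']
    · have hfa : fn f' b' = a := by rw [← hf, hb]; exact h'.fn_eq
      have hL : ¬ Lo a := fun hL => (h'.lt b' hb' hfa hL).not_ge (hb ▸ hbb)
      have h1 : (label y (φ b')).1 = a := by rw [hφ]; exact hfa
      rw [show φ b = ε by simp [φ, hb]]
      by_cases h2 : φ b' = ε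
      · exact h2.ge
      · exact (h.gt _ h2 h1 hL).le
    · have hfa : fn f' b = a := by rw [hf, hb']; exact h'.fn_eq
      have hL : Lo a := by
        by_contra hL
        exact (h'.gt b hb hfa hL).not_ge (hb' ▸ hbb)
      have h1 : (label y (φ b)).1 = a := by rw [hφ]; exact hfa
      rw [show φ b' = ε by simp [φ, hb']]
      by_cases h2 : φ b = ε
      · exact h2.le
      · exact (h.lt _ h2 h1 hL).le
    · rcases hbb.eq_or_lt with h1 | h1
      · rw [h1]
      · simp only [φ, hb, hb', if_false]
        refine fn_mono g (lt_of_fn_lt i ?_).le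
        rwa [hc b hb, hc b' hb'])
  exact ⟨u, label_ext fun s => by rw [label_map, hu, hφ]⟩

end

/-- The hypotheses leave two choices for `Lo`: the edges below `a`, or these together with `a`. The
new edge labelled `(a, q)` is then the lowest, respectively the topmost, edge over `a`. `H1` makes
it very inner, while `H2` and `H3` say that inserting it leads neither out of the smaller family
(within the larger one) nor out of the larger one. Thus a marked section and its face omitting the
marked edge are missing together, and both are supplied by filling the horn at that edge. -/
theorem llp_rlp_labelSub (T : ClosedTree) (a : T.obj.Edge) (q : Bool) (Lo : T.obj.Edge → Prop)
    (hLo : ∀ t, Lo t → t ≤ a) (hLo' : ∀ t, t < a → Lo t)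
    (P P' : Set (T.obj.Edge × Bool) → Prop) (hP : ∀ ρ ρ', ρ ⊆ ρ' → P ρ' → P ρ)
    (hP' : ∀ ρ ρ', ρ ⊆ ρ' → P' ρ' → P' ρ) (hPP' : labelSub T P hP ≤ labelSub T P' hP')
    (H1 : ∀ ρ, P' ρ → ¬ P ρ → (∃ z ∈ ρ, z ≠ (a, q) ∧ Lo z.1) ∧
      ∃ z ∈ ρ, z ≠ (a, q) ∧ a ≤ z.1 ∧ ¬ Lo z.1)
    (H2 : ∀ ρ, P' (insert (a, q) ρ) → P ρ → P (insert (a, q) ρ))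
    (H3 : ∀ ρ, P' ρ → ¬ P ρ → P' (insert (a, q) ρ)) :
    VeryInnerHornInclusion.rlp.llp (Subfunctor.homOfLe hPP') := by
  let Y : ClosedDendroidalSet := labelings ⊗ yoneda.obj T
  -- This invariant keeps each marked section paired with its face omitting `ε`. It guarantees that
  -- the part of a new cell already present is no larger than the horn.
  let C : Subfunctor Y → Prop := fun Z => ∀ (S R : ClosedTree) (y : Y.obj (op S)) (ε : S.obj.Edge)
    (i : R ⟶ S), P' (Set.range (label y)) → IsMarked a q Lo y ε → {ε}ᶜ ⊆ Set.range (fn i) →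
      Y.map i.op y ∈ Z.obj (op R) → y ∈ Z.obj (op S)
  refine llp_rlp_homOfLe_of_attach _ _ _ hPP' C ?_ ?_ ?_
  · intro c _ hc S R y ε i h1 h2 h3 h4
    simp only [Subfunctor.sSup_obj, Set.sSup_eq_sUnion, Set.mem_sUnion, Set.mem_image,
      exists_exists_and_eq_and] at h4 ⊢
    obtain ⟨Z, hZ, h4⟩ := h4
    exact ⟨Z, hZ, hc Z hZ S R y ε i h1 h2 h3 h4⟩
  · intro S R y ε i h1 h2 h3 h4
    have h5 : Set.range (label y) =
        insert (a, q) (Set.range (label (Y.map i.op y))) := by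
      ext z
      constructor
      · rintro ⟨s, rfl⟩
        by_cases hs : s = ε
        · rw [hs, h2.label_eq]
          exact Or.inl rfl
        · obtain ⟨r, rfl⟩ := h3 hs
          exact Or.inr ⟨r, rfl⟩
      · rintro (rfl | ⟨r, rfl⟩)
        · exact ⟨ε, h2.label_eq⟩
        · exact ⟨_, rfl⟩
    rw [mem_labelSub] at h4 ⊢
    rw [h5] at h1 ⊢
    exact H2 _ h1 h4
  · intro Z hZ hZ' hCZ hne
    -- Any missing section is a restriction of a missing marked one, by insertion. With the number
    -- of edges minimal, all proper faces through `ε` are already present, and so is the whole horn.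
    have hex : ∃ (n : ℕ) (S : ClosedTree) (y : Y.obj (op S)) (ε : S.obj.Edge),
        P' (Set.range (label y)) ∧ IsMarked a q Lo y ε ∧ y ∉ Z.obj (op S) ∧
        Fintype.card S.obj.Edge = n := by
      have h1 : ∃ (S : ClosedTree) (y : Y.obj (op S)), P' (Set.range (label y)) ∧
          y ∉ Z.obj (op S) := by
        by_contra! hcon
        exact hne (le_antisymm hZ' fun U y hy => hcon U.unop y hy)
      obtain ⟨S, y, hy, hyZ⟩ := h1
      have hyP : ¬ P (Set.range (label y)) := fun h => hyZ (hZ _ h)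
      obtain ⟨⟨z, hz, -, hz'⟩, -⟩ := H1 _ hy hyP
      obtain ⟨S', y', ε, i, h1, h2, h3⟩ := exists_insert a q Lo hLo hLo' y ⟨z, hz, hz'⟩
      refine ⟨_, S', y', ε, ?_, h1, ?_, rfl⟩
      · rw [h3]
        exact H3 _ hy hyP
      · intro h4
        apply hyZ
        rw [← h2]
        exact Z.map i.op h4
    classical
    obtain ⟨S, y, ε, hy, hm, hyZ, hcard⟩ := Nat.find_spec hex
    have hmin : ∀ (S' : ClosedTree) (y' : Y.obj (op S')) (ε' : S'.obj.Edge),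
        P' (Set.range (label y')) → IsMarked a q Lo y' ε' →
        Fintype.card S'.obj.Edge < Fintype.card S.obj.Edge → y' ∈ Z.obj (op S') := by
      intro S' y' ε' h1 h2 h3
      by_contra h4
      rw [hcard] at h3
      exact Nat.find_min hex h3 ⟨S', y', ε', h1, h2, h4, rfl⟩
    have hyP : ¬ P (Set.range (label y)) := fun h => hyZ (hZ _ h)
    have hvi : S.obj.IsVeryInner ε := hm.isVeryInner hLo (H1 _ hy hyP).1 (H1 _ hy hyP).2
    have hhorn : ∀ (R : ClosedTree) (g : R ⟶ S), g ∈ (horn S ε).obj (op R) →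
        Y.map g.op y ∈ Z.obj (op R) := by
      intro R g hg
      obtain ⟨F, i, σ, hi, hi', ⟨ε', hε'⟩, rfl⟩ := exists_face_of_mem_horn hvi hg
      rw [op_comp, Functor.map_comp, types_comp_apply]
      refine Z.map σ.op (hmin F _ ε' (hP' _ _ (range_label_map y i) hy) (hm.map i hε' hi) ?_)
      exact Fintype.card_lt_of_injective_not_surjective _ hi hi'
    have hnot : ∀ (R : ClosedTree) (g : R ⟶ S), g ∉ (horn S ε).obj (op R) →
        {ε}ᶜ ⊆ Set.range (fn g) := by
      intro R g hg d hd
      by_contra hdg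
      exact hg ((mem_horn_iff hvi g).2 ⟨d, hd, hdg⟩)
    refine ⟨S, y, horn S ε, ⟨S, ε, hvi⟩, hy, hyZ, fun R g => ⟨hhorn R g, fun hg => ?_⟩, ?_, ?_⟩
    · by_contra hg'
      exact hyZ (hCZ S R y ε g hy hm (hnot R g hg') hg)
    · intro R g g' hg hg' hgg
      refine IsMarked.hom_ext (y := y) (ε := ε) ?_ (hnot R g hg) (hnot R g' hg') (fun r => ?_)
      -- Without such a gap, `y` would be its own restriction along an endomorphism lying in the
      -- horn, hence already present.
      · intro s s' hs hss
        by_contra! hno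
        obtain ⟨u, hu, d, hd, hd'⟩ := hm.exists_collapse hs hss
          (fun t ht h1 h2 => hno t ht h1 h2)
        refine hyZ ?_
        rw [← hu]
        exact hhorn S u ((mem_horn_iff hvi u).2 ⟨d, hd, hd'⟩)
      · rw [← label_map, hgg, label_map]
    · rintro S' R y' ε' i h1 h2 h3 (h4 | ⟨g, hg⟩)
      · exact Or.inl (hCZ S' R y' ε' i h1 h2 h3 h4)
      · obtain ⟨g', hg'⟩ := hm.exists_extension h2 i g.unop h3 (fun r => by
          rw [← label_map, ← label_map]
          exact congrArg (fun z => label (S := R) z r) hg)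
        exact Or.inr ⟨g'.op, hg'⟩

lemma llp_ι_of_homOfLe (W : MorphismProperty ClosedDendroidalSet) {Y : ClosedDendroidalSet}
    {X X' : Subfunctor Y} {h : X ≤ X'} (hW : W.llp (Subfunctor.homOfLe h)) (h' : X' = ⊤) :
    W.llp X.ι := by
  subst h'
  rw [← Subfunctor.homOfLe_ι h]
  exact W.llp.comp_mem _ _ hW (MorphismProperty.of_isIso _ _)

/-! ### Prisms over horns and boundaries -/

/-- The prism over the very inner horn of `T` at `e`, together with the two ends. -/
def hornPrism (T : ClosedTree) (e : T.obj.Edge) :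
    Subfunctor (labelings ⊗ yoneda.obj T : ClosedDendroidalSet) :=
  labelSub T (fun ρ => (∃ d, d ≠ e ∧ ∀ z ∈ ρ, z.1 ≠ d) ∨ (∀ z ∈ ρ, z.2 = false) ∨
      ∀ z ∈ ρ, z.2 = true)
    (by
      rintro ρ ρ' h (⟨d, hd, h'⟩ | h' | h')
      · exact Or.inl ⟨d, hd, fun z hz => h' z (h hz)⟩
      · exact Or.inr (Or.inl fun z hz => h' z (h hz))
      · exact Or.inr (Or.inr fun z hz => h' z (h hz)))

/-- The prism over the boundary of `T`, together with one end. -/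
def boundaryPrism (T : ClosedTree) :
    Subfunctor (labelings ⊗ yoneda.obj T : ClosedDendroidalSet) :=
  labelSub T (fun ρ => (∃ d, ∀ z ∈ ρ, z.1 ≠ d) ∨ ∀ z ∈ ρ, z.2 = false)
    (by
      rintro ρ ρ' h (⟨d, h'⟩ | h')
      · exact Or.inl ⟨d, fun z hz => h' z (h hz)⟩
      · exact Or.inr fun z hz => h' z (h hz))

/-- Inserting `(e, false)` alone would not preserve the `true` end. The intermediate family `P₁`
enlarges that end by allowing any labels over `e`; it is reached by inserting `(e, true)`, and
everything else by inserting `(e, false)`. Sections outside the prism hit the root and an edge above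
`e`, so the inserted edge is very inner. -/
lemma llp_rlp_hornPrism (T : ClosedTree) (e : T.obj.Edge) (he : T.obj.IsVeryInner e) :
    VeryInnerHornInclusion.rlp.llp (hornPrism T e).ι := by
  rw [isVeryInner_iff] at he
  obtain ⟨he, x, hx⟩ := he
  have hr := rootEdge_lt he
  let P₁ : Set (T.obj.Edge × Bool) → Prop := fun ρ =>
    (∃ d, d ≠ e ∧ ∀ z ∈ ρ, z.1 ≠ d) ∨ (∀ z ∈ ρ, z.2 = false) ∨ ∀ z ∈ ρ, z.1 ≠ e → z.2 = true
  have hP₁ : ∀ ρ ρ', ρ ⊆ ρ' → P₁ ρ' → P₁ ρ := by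
    rintro ρ ρ' h (⟨d, hd, h'⟩ | h' | h')
    · exact Or.inl ⟨d, hd, fun z hz => h' z (h hz)⟩
    · exact Or.inr (Or.inl fun z hz => h' z (h hz))
    · exact Or.inr (Or.inr fun z hz => h' z (h hz))
  have hmeet : ∀ ρ : Set (T.obj.Edge × Bool), (¬ ∃ d, d ≠ e ∧ ∀ z ∈ ρ, z.1 ≠ d) → ∀ d, d ≠ e →
      ∃ z ∈ ρ, z.1 = d := by
    intro ρ h d hd
    by_contra! h'
    exact h ⟨d, hd, h'⟩
  have H1 : ∀ (q : Bool) (ρ : Set (T.obj.Edge × Bool)), (¬ ∃ d, d ≠ e ∧ ∀ z ∈ ρ, z.1 ≠ d) →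
      (∃ z ∈ ρ, z ≠ (e, q) ∧ z.1 < e) ∧ ∃ z ∈ ρ, z ≠ (e, q) ∧ e ≤ z.1 ∧ ¬ z.1 < e := by
    intro q ρ h
    obtain ⟨z, hz, hzr⟩ := hmeet ρ h _ hr.ne
    obtain ⟨w, hw, hwx⟩ := hmeet ρ h _ hx.ne'
    refine ⟨⟨z, hz, ?_, hzr ▸ hr⟩, w, hw, ?_, hwx ▸ hx.le, hwx ▸ hx.not_gt⟩
    · rintro rfl
      exact hr.ne hzr.symm
    · rintro rfl
      exact hx.ne hwx
  have hle₁ : hornPrism T e ≤ labelSub T P₁ hP₁ := by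
    rintro U y (h | h | h)
    · exact Or.inl h
    · exact Or.inr (Or.inl h)
    · exact Or.inr (Or.inr fun z hz _ => h z hz)
  have hle₂ : labelSub T P₁ hP₁ ≤ labelSub T (fun _ => True) (fun _ _ _ _ => trivial) :=
    fun _ _ _ => trivial
  have h₁ : VeryInnerHornInclusion.rlp.llp (Subfunctor.homOfLe hle₁) := by
    refine llp_rlp_labelSub T e true (fun t => t < e) (fun t ht => ht.le) (fun t ht => ht)
      _ P₁ _ hP₁ hle₁ (fun ρ _ hρ => H1 true ρ fun h => hρ (Or.inl h)) ?_ ?_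
    · rintro ρ h (⟨d, hd, h'⟩ | h' | h')
      · refine Or.inl ⟨d, hd, ?_⟩
        rintro z (rfl | hz)
        exacts [hd.symm, h' z hz]
      · rcases h with h | h | h
        · exact Or.inl h
        · simpa using h (e, true) (Or.inl rfl)
        -- All labels are `false`, yet all labels away from `e` are `true`: nothing lies over the
        -- root.
        · refine Or.inl ⟨T.obj.rootEdge, hr.ne, ?_⟩
          rintro z (rfl | hz) hzr
          · exact hr.ne hzr.symm
          · have h3 := h z (Or.inr hz) (hzr.trans_ne hr.ne)
            rw [h' z hz] at h3
            simp at h3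
      · refine Or.inr (Or.inr ?_)
        rintro z (rfl | hz)
        exacts [rfl, h' z hz]
    · rintro ρ (h | h | h) h'
      · exact absurd (Or.inl h) h'
      · exact absurd (Or.inr (Or.inl h)) h'
      · refine Or.inr (Or.inr ?_)
        rintro z (rfl | hz) hze
        exacts [rfl, h z hz hze]
  have h₂ : VeryInnerHornInclusion.rlp.llp (Subfunctor.homOfLe hle₂) := by
    refine llp_rlp_labelSub T e false (fun t => t < e) (fun t ht => ht.le) (fun t ht => ht)
      P₁ _ hP₁ _ hle₂ (fun ρ _ hρ => H1 false ρ fun h => hρ (Or.inl h)) ?_ (fun _ _ _ => trivial)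
    rintro ρ h (⟨d, hd, h'⟩ | h' | h')
    · refine Or.inl ⟨d, hd, ?_⟩
      rintro z (rfl | hz)
      exacts [hd.symm, h' z hz]
    · refine Or.inr (Or.inl ?_)
      rintro z (rfl | hz)
      exacts [rfl, h' z hz]
    · refine Or.inr (Or.inr ?_)
      rintro z (rfl | hz) hze
      exacts [absurd rfl hze, h' z hz hze]
  exact llp_ι_of_homOfLe _ (h := hle₁.trans hle₂)
    (VeryInnerHornInclusion.rlp.llp.comp_mem _ _ h₁ h₂) rfl

/-- The requirement that labels be `false` is lifted one edge `a` at a time, the root coming last. A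
newly admitted section has an edge labelled `(a, true)`, and an edge labelled `(a, false)` is
inserted below all edges over `a`. -/
lemma llp_rlp_boundaryPrism (T : ClosedTree) (x : T.obj.Edge) (hx : x ≠ T.obj.rootEdge) :
    VeryInnerHornInclusion.rlp.llp (boundaryPrism T).ι := by
  classical
  let P : Finset T.obj.Edge → Set (T.obj.Edge × Bool) → Prop := fun D ρ =>
    (∃ d, ∀ z ∈ ρ, z.1 ≠ d) ∨ ∀ z ∈ ρ, z.1 ∈ D → z.2 = false
  have hP : ∀ D ρ ρ', ρ ⊆ ρ' → P D ρ' → P D ρ := by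
    rintro D ρ ρ' h (⟨d, h'⟩ | h')
    · exact Or.inl ⟨d, fun z hz => h' z (h hz)⟩
    · exact Or.inr fun z hz => h' z (h hz)
  have hmeet : ∀ D ρ, ¬ P D ρ → ∀ d, ∃ z ∈ ρ, z.1 = d := by
    intro D ρ h d
    by_contra! h'
    exact h (Or.inl ⟨d, h'⟩)
  have hins : ∀ (D : Finset T.obj.Edge) (a : T.obj.Edge) (ρ : Set (T.obj.Edge × Bool)),
      P D (insert (a, false) ρ) → P (insert a D) ρ → P (insert a D) (insert (a, false) ρ) := by
    rintro D a ρ (h | h) h'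
    · exact Or.inl h
    · rcases h' with ⟨d, h'⟩ | h'
      -- If the omitted edge is `a`, the insertion fills it, but then the only label over `a` is the
      -- new `false`.
      · by_cases hd : d = a
        · subst hd
          refine Or.inr ?_
          rintro z (rfl | hz) hzD
          · rfl
          · rcases Finset.mem_insert.1 hzD with h3 | h3
            · exact absurd h3 (h' z hz)
            · exact h z (Or.inr hz) h3
        · refine Or.inl ⟨d, ?_⟩
          rintro z (rfl | hz)
          exacts [Ne.symm hd, h' z hz]
      · refine Or.inr ?_
        rintro z (rfl | hz) hzD
        exacts [rfl, h' z hz hzD]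
  have hmono : ∀ D D' : Finset T.obj.Edge, D ⊆ D' → labelSub T (P D') (hP D') ≤
      labelSub T (P D) (hP D) := by
    rintro D D' hD U y (h | h)
    · exact Or.inl h
    · exact Or.inr fun z hz hzD => h z hz (hD hzD)
  have hdown : ∀ (n : ℕ) (D : Finset T.obj.Edge), (Dᶜ).card = n → T.obj.rootEdge ∈ D →
      (∀ t ∈ D, ∀ t', t' ≤ t → t' ∈ D) →
      VeryInnerHornInclusion.rlp.llp (Subfunctor.homOfLe (hmono D _ (Finset.subset_univ D))) := by
    intro n
    induction n with
    | zero =>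
      intro D hD _ _
      obtain rfl : D = Finset.univ := by simpa using hD
      exact (VeryInnerHornInclusion.rlp.llp).id_mem _
    | succ n ih =>
      intro D hD hr hdown
      have hne : (Dᶜ).Nonempty := Finset.card_pos.1 (by omega)
      obtain ⟨a, ha⟩ := (Dᶜ).exists_minimal hne
      have haD : a ∉ D := by simpa using ha.prop
      have hlt : ∀ t, t < a → t ∈ D := by
        intro t ht
        by_contra htD
        exact ht.not_ge (ha.le_of_le (by simpa using htD) ht.le)
      have hra : T.obj.rootEdge < a := rootEdge_lt (fun h => haD (h ▸ hr))
      have h1 := ih (insert a D) (by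
          have h2 : Dᶜ = insert a (insert a D)ᶜ := by
            ext t
            by_cases hta : t = a <;> simp [hta, haD]
          rw [h2, Finset.card_insert_of_notMem (by simp)] at hD
          omega) (Finset.mem_insert_of_mem hr) (by
          intro t ht t' htt'
          rcases Finset.mem_insert.1 ht with rfl | h
          · rcases htt'.eq_or_lt with h' | h'
            · exact h' ▸ Finset.mem_insert_self _ _
            · exact Finset.mem_insert_of_mem (hlt _ h')
          · exact Finset.mem_insert_of_mem (hdown t h t' htt'))
      have h2 : VeryInnerHornInclusion.rlp.llp
          (Subfunctor.homOfLe (hmono D _ (Finset.subset_insert a D))) := by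
        refine llp_rlp_labelSub T a false (fun t => t < a) (fun t ht => ht.le) (fun t ht => ht)
          _ _ _ _ (hmono D _ (Finset.subset_insert a D)) ?_ (hins D a) ?_
        · intro ρ hρ hρ'
          obtain ⟨z, hz, hzr⟩ := hmeet _ _ hρ' T.obj.rootEdge
          have hρD : ∀ z ∈ ρ, z.1 ∈ D → z.2 = false := by
            rcases hρ with h | h
            · exact absurd (Or.inl h) hρ'
            · exact h
          have hw : ∃ w ∈ ρ, w.1 = a ∧ w.2 ≠ false := by
            by_contra! hw
            refine hρ' (Or.inr fun z hz hzD => ?_)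
            rcases Finset.mem_insert.1 hzD with h3 | h3
            · exact hw z hz h3
            · exact hρD z hz h3
          obtain ⟨w, hw, hwa, hw'⟩ := hw
          refine ⟨⟨z, hz, ?_, hzr ▸ hra⟩, w, hw, ?_, hwa.ge, hwa.not_lt⟩
          · rintro rfl
            exact hra.ne hzr.symm
          · rintro rfl
            exact hw' rfl
        · rintro ρ (h | h) h'
          · exact absurd (Or.inl h) h'
          · refine Or.inr ?_
            rintro z (rfl | hz) hzD
            exacts [rfl, h z hz hzD]
      exact VeryInnerHornInclusion.rlp.llp.comp_mem _ _ h1 h2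
  have h₁ := hdown _ {T.obj.rootEdge} rfl (by simp) (by
    intro t ht t' htt'
    rw [Finset.mem_singleton] at ht ⊢
    exact le_antisymm (ht ▸ htt') (T.obj.rootEdge_le _))
  have hle₀ : boundaryPrism T ≤ labelSub T (P Finset.univ) (hP _) := by
    rintro U y (h | h)
    · exact Or.inl h
    · exact Or.inr fun z hz _ => h z hz
  have heq : boundaryPrism T = labelSub T (P Finset.univ) (hP _) := by
    refine le_antisymm hle₀ ?_
    rintro U y (h | h)
    · exact Or.inl h
    · exact Or.inr fun z hz => h z hz (Finset.mem_univ _)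
  have hle₂ : labelSub T (P {T.obj.rootEdge}) (hP _) ≤
      labelSub T (fun _ => True) (fun _ _ _ _ => trivial) := fun _ _ _ => trivial
  have h₂ : VeryInnerHornInclusion.rlp.llp (Subfunctor.homOfLe hle₂) := by
    -- Nothing in `T` lies below the root, so here the new edge goes on top of the edges over the
    -- root. One of these, labelled `true`, lies below it and an edge over `x` above it; this is
    -- where a second edge of `T` is needed.
    refine llp_rlp_labelSub T T.obj.rootEdge false (fun t => t ≤ T.obj.rootEdge)
      (fun t ht => ht) (fun t ht => ht.le) _ _ _ _ hle₂ ?_ ?_ (fun _ _ _ => trivial)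
    · intro ρ _ hρ
      obtain ⟨z, hz, hzx⟩ := hmeet _ _ hρ x
      have hw : ∃ w ∈ ρ, w.1 = T.obj.rootEdge ∧ w.2 ≠ false := by
        by_contra! hw
        exact hρ (Or.inr fun z hz hzD => hw z hz (by simpa using hzD))
      obtain ⟨w, hw, hwr, hw'⟩ := hw
      refine ⟨⟨w, hw, ?_, hwr.le⟩, z, hz, ?_, T.obj.rootEdge_le _, ?_⟩
      · rintro rfl
        exact hw' rfl
      · rintro rfl
        exact hx hzx.symm
      · rw [hzx]
        exact (rootEdge_lt hx).not_ge
    · intro ρ _ hρ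
      have h3 : insert T.obj.rootEdge (∅ : Finset T.obj.Edge) = {T.obj.rootEdge} := rfl
      have h4 := hins ∅ T.obj.rootEdge ρ (Or.inr (by simp))
      rw [h3] at h4
      exact h4 hρ
  rw [heq]
  exact llp_ι_of_homOfLe _ (h := (hmono _ _ (Finset.subset_univ _)).trans hle₂)
    (VeryInnerHornInclusion.rlp.llp.comp_mem _ _ h₁ h₂) rfl

/-! ### Pushout-products and lifting -/

section

variable {L F : ClosedDendroidalSet} (κ : Subfunctor L) (A : Subfunctor F)

/-- The union of `L ⊗ A` and `κ ⊗ F` in `L ⊗ F`. -/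
def prodSub : Subfunctor (L ⊗ F : ClosedDendroidalSet) where
  obj U := {x | x.1 ∈ κ.obj U ∨ x.2 ∈ A.obj U}
  map g _ hx := hx.imp (fun h => κ.map g h) (fun h => A.map g h)

/-- The pushout-product of two inclusions of subfunctors. -/
noncomputable def prodSubPushout :
    (curriedTensor ClosedDendroidalSet).PushoutObjObj κ.ι A.ι where
  pt := (prodSub κ A).toFunctor
  inl := Subfunctor.lift (L ◁ A.ι) (by
    rintro U _ ⟨x, rfl⟩
    exact Or.inr x.2.2)
  inr := Subfunctor.lift (κ.ι ▷ F) (by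
    rintro U _ ⟨x, rfl⟩
    exact Or.inl x.1.2)
  isPushout := by
    refine IsPushout.of_forall_isPushout_app fun U => ?_
    have h₁ : Function.Injective ((L ◁ A.ι).app U) := fun x y h =>
      Prod.ext (Prod.ext_iff.1 h).1 (Subtype.ext (Prod.ext_iff.1 h).2)
    have h₂ : Function.Injective ((κ.ι ▷ F).app U) := fun x y h =>
      Prod.ext (Subtype.ext (Prod.ext_iff.1 h).1) (Prod.ext_iff.1 h).2
    have := (mono_iff_injective ((L ◁ A.ι).app U)).2 h₁
    refine Types.isPushout_of_isPullback_of_mono (k := (prodSub κ A).ι.app U)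
      (r' := (L ◁ A.ι).app U) (b' := (κ.ι ▷ F).app U) ?_ rfl rfl ?_ fun x y _ _ h => h₂ h
    · rw [Types.isPullback_iff]
      refine ⟨rfl, fun x y h => ?_, fun x y h => ⟨(y.1, x.2), ?_, ?_⟩⟩
      · exact Prod.ext (Prod.ext_iff.1 h.2).1 (Prod.ext_iff.1 h.1).2
      · exact Prod.ext (Prod.ext_iff.1 h).1.symm rfl
      · exact Prod.ext rfl (Prod.ext_iff.1 h).2
    · refine Set.eq_univ_of_forall ?_
      rintro ⟨x, hx | hx⟩
      · exact Or.inr ⟨(⟨x.1, hx⟩, x.2), rfl⟩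
      · exact Or.inl ⟨(x.1, ⟨x.2, hx⟩), rfl⟩
  ι := (prodSub κ A).ι
  inl_ι := rfl
  inr_ι := rfl

/-- To solve lifting problems against `p` for the pushout-product of `κ.ι` and a morphism in the
class generated by `I`, it suffices to solve them for the morphisms in `I`. -/
lemma exists_lift_of_llp_rlp {L : ClosedDendroidalSet} (κ : Subfunctor L)
    (I : MorphismProperty ClosedDendroidalSet) {E D : ClosedDendroidalSet} (p : E ⟶ D)
    (hI : ∀ {X Y : ClosedDendroidalSet} (g : X ⟶ Y), I g →
      ∃ sq : (curriedTensor ClosedDendroidalSet).PushoutObjObj κ.ι g, HasLiftingProperty sq.ι p)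
    {A B : ClosedDendroidalSet} {i : A ⟶ B} (hi : I.rlp.llp i)
    (u : L ⊗ A ⟶ E) (v : κ.toFunctor ⊗ B ⟶ E) (w : L ⊗ B ⟶ D)
    (huv : κ.ι ▷ A ≫ u = κ.toFunctor ◁ i ≫ v) (hu : u ≫ p = L ◁ i ≫ w)
    (hv : v ≫ p = κ.ι ▷ B ≫ w) :
    ∃ H : L ⊗ B ⟶ E, L ◁ i ≫ H = u ∧ κ.ι ▷ B ≫ H = v ∧ H ≫ p = w := by
  -- By adjunction, lifting the pushout-product against `p` amounts to lifting the second factor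
  -- against the pullback-hom of `κ.ι` and `p`. So it is enough that the pullback-hom lies in
  -- `I.rlp`.
  let sq₁₃ := Functor.PullbackObjObj.ofHasPullback MonoidalClosed.internalHom κ.ι p
  have h₁₃ : I.rlp sq₁₃.π := by
    intro X Y g hg
    obtain ⟨sq, hsq⟩ := hI g hg
    rwa [← MonoidalClosed.internalHomAdjunction₂.hasLiftingProperty_iff sq]
  let sq := Functor.PushoutObjObj.ofHasPushout (curriedTensor ClosedDendroidalSet) κ.ι i
  have hsq : HasLiftingProperty sq.ι p := by
    rw [MonoidalClosed.internalHomAdjunction₂.hasLiftingProperty_iff sq sq₁₃]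
    exact hi _ h₁₃
  have hc : CommSq (sq.isPushout.desc u v huv) sq.ι p w := ⟨by
    apply sq.hom_ext
    · rw [IsPushout.inl_desc_assoc, sq.inl_ι_assoc]
      exact hu
    · rw [IsPushout.inr_desc_assoc, sq.inr_ι_assoc]
      exact hv⟩
  refine ⟨hc.lift, ?_, ?_, hc.fac_right⟩
  · have := sq.inl ≫= hc.fac_left
    rwa [IsPushout.inl_desc, sq.inl_ι_assoc] at this
  · have := sq.inr ≫= hc.fac_left
    rwa [IsPushout.inr_desc, sq.inr_ι_assoc] at this

end

/-- The labelings with constant value `false`. -/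
def falseEnd : Subfunctor labelings where
  obj U := {φ | ∀ s, (show U.unop.obj.Edge → Bool from φ) s = false}
  map _ _ h _ := h _

/-- The constant labelings. -/
def bothEnds : Subfunctor labelings where
  obj U := {φ | (∀ s, (show U.unop.obj.Edge → Bool from φ) s = false) ∨
    ∀ s, (show U.unop.obj.Edge → Bool from φ) s = true}
  map _ _ h := h.imp (fun h _ => h _) (fun h _ => h _)

lemma prodSub_bothEnds_horn (T : ClosedTree) (e : T.obj.Edge) (he : T.obj.IsVeryInner e) :
    prodSub bothEnds (horn T e) = hornPrism T e := by
  ext U y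
  have h1 : y ∈ (prodSub bothEnds (horn T e)).obj U ↔ y.1 ∈ bothEnds.obj U ∨
    (show U.unop ⟶ T from y.2) ∈ (horn T e).obj (op U.unop) := Iff.rfl
  rw [h1, mem_horn_iff he]
  change _ ↔ y ∈ (labelSub T _ _).obj (op U.unop)
  rw [mem_labelSub]
  simp only [Set.forall_mem_range, label]
  rw [or_comm]
  simp only [Set.mem_range, not_exists]
  rfl

/-! ### Normal monomorphisms and boundaries -/

/-- The boundary of `T`: the morphisms to `T` which are not surjective on edges. -/
def boundary (T : ClosedTree) : Subfunctor (yoneda.obj T) where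
  obj U := {f | ¬ Function.Surjective (fn (show U.unop ⟶ T from f))}
  map g f hf := fun h => hf fun t => by
    obtain ⟨s, hs⟩ := h t
    exact ⟨fn g.unop s, hs⟩

lemma mem_boundary {S T : ClosedTree} (f : S ⟶ T) :
    f ∈ (boundary T).obj (op S) ↔ ¬ Function.Surjective (fn f) := Iff.rfl

lemma prodSub_falseEnd_boundary (T : ClosedTree) :
    prodSub falseEnd (boundary T) = boundaryPrism T := by
  ext U y
  have h1 : y ∈ (prodSub falseEnd (boundary T)).obj U ↔ y.1 ∈ falseEnd.obj U ∨
    (show U.unop ⟶ T from y.2) ∈ (boundary T).obj (op U.unop) := Iff.rfl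
  rw [h1, mem_boundary]
  change _ ↔ y ∈ (labelSub T _ _).obj (op U.unop)
  rw [mem_labelSub]
  simp only [Set.forall_mem_range, label, Function.Surjective, not_forall, not_exists]
  rw [or_comm]
  rfl

/-- The boundary inclusions of the trees with an edge other than the root. -/
inductive BoundaryInclusion : MorphismProperty ClosedDendroidalSet
  | mk (T : ClosedTree) (x : T.obj.Edge) (hx : x ≠ T.obj.rootEdge) :
      BoundaryInclusion (boundary T).ι

/-- A normal monomorphism which is surjective on trees with a single edge is in the class
generated by the boundary inclusions of the trees with several edges. -/
lemma IsNormalMono.llp_rlp_boundaryInclusion {B C : ClosedDendroidalSet} {j : B ⟶ C}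
    (hj : IsNormalMono j)
    (h₀ : ∀ (S : ClosedTree) (y : C.obj (op S)), (∀ s, s = S.obj.rootEdge) →
      y ∈ (Subfunctor.range j).obj (op S)) :
    BoundaryInclusion.rlp.llp j := by
  classical
  obtain ⟨hm, hj⟩ := hj
  have key : BoundaryInclusion.rlp.llp
      (Subfunctor.homOfLe (le_top : Subfunctor.range j ≤ ⊤)) := by
    refine llp_rlp_homOfLe_of_attach _ _ _ _ (fun _ => True) (fun _ _ _ => trivial) trivial ?_
    intro Z hXZ _ _ hZ
    have hex : ∃ n : ℕ, ∃ (S : ClosedTree) (y : C.obj (op S)), y ∉ Z.obj (op S) ∧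
        Fintype.card S.obj.Edge = n := by
      by_contra! hcon
      refine hZ (le_antisymm le_top fun U y _ => ?_)
      by_contra hy
      exact hcon _ U.unop y hy rfl
    obtain ⟨S, y, hy, hcard⟩ := Nat.find_spec hex
    have hmin : ∀ (S' : ClosedTree) (y' : C.obj (op S')),
        Fintype.card S'.obj.Edge < Fintype.card S.obj.Edge → y' ∈ Z.obj (op S') := by
      intro S' y' h3
      by_contra h4
      rw [hcard] at h3
      exact Nat.find_min hex h3 ⟨S', y', h4, rfl⟩
    -- A non-surjective morphism factors through its image, a smaller tree, where minimality
    -- applies. Surjective ones have sections, so the part of the cell already present is exactly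
    -- the boundary.
    have hns : ∀ (R : ClosedTree) (g : R ⟶ S), ¬ Function.Surjective (fn g) →
        C.map g.op y ∈ Z.obj (op R) := by
      intro R g hg
      obtain ⟨F, i, hi, hi', -⟩ := exists_subtree S (Set.range (fn g)) (fn g R.obj.rootEdge)
        ⟨_, rfl⟩ (by
          rintro _ ⟨r, rfl⟩
          exact fn_mono g (R.obj.rootEdge_le r))
      obtain ⟨σ, rfl⟩ := exists_lift i g hi'.ge
      rw [op_comp, Functor.map_comp, types_comp_apply]
      refine Z.map σ.op (hmin F _ (Fintype.card_lt_of_injective_not_surjective _ hi fun h => hg ?_))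
      rw [← Set.range_eq_univ] at h ⊢
      rw [← h, hi']
    have hsurj : ∀ (R : ClosedTree) (g : R ⟶ S), C.map g.op y ∈ Z.obj (op R) →
        ¬ Function.Surjective (fn g) := by
      intro R g hg hs
      obtain ⟨σ, hσ, -⟩ := exists_section g hs R.obj.rootEdge
      apply hy
      have := Z.map σ.op hg
      rwa [Set.mem_preimage, ← types_comp_apply, ← Functor.map_comp, ← op_comp, hσ, op_id,
        Functor.map_id_apply] at this
    obtain ⟨x, hx⟩ : ∃ x, x ≠ S.obj.rootEdge := by
      by_contra! h
      exact hy (hXZ _ (h₀ S y h))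
    refine ⟨S, y, boundary S, ⟨S, x, hx⟩, trivial, hy,
      fun R g => ⟨fun h => hns R g h, fun h => hsurj R g h⟩, ?_, trivial⟩
    intro R g g' hg hg' hgg
    rw [mem_boundary, not_not] at hg hg'
    apply ClosedTree.hom_ext
    intro r
    -- With a section of `g` through `r`, the composite `σ ≫ g'` fixes `y`, so it is an
    -- automorphism, and by normality the identity. Evaluating at `g r` gives `g' r = g r`.
    obtain ⟨σ, hσ, hr⟩ := exists_section g hg r
    have hu : C.map (σ ≫ g').op y = y := by
      rw [op_comp, Functor.map_comp_apply, ← hgg, ← Functor.map_comp_apply,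
        ← op_comp, hσ, op_id, Functor.map_id_apply]
    have hus : Function.Surjective (fn (σ ≫ g')) := by
      by_contra h
      exact hy (hu ▸ hns S _ h)
    have := isIso_of_bijective _ ⟨Finite.injective_iff_surjective.2 hus, hus⟩
    have h1 := congrArg Iso.hom (hj S y (fun h => hy (hXZ _ h)) (asIso (σ ≫ g')) hu)
    have h2 : fn (σ ≫ g') (fn g r) = fn g r := by
      rw [show σ ≫ g' = 𝟙 S from h1, fn_id]
    rw [← h2, fn_comp, hr]
  rw [← Subfunctor.toRange_ι j, ← Subfunctor.homOfLe_ι (le_top : Subfunctor.range j ≤ ⊤)]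
  exact (BoundaryInclusion.rlp.llp).comp_mem _ _ (of_isIso _ _)
    ((BoundaryInclusion.rlp.llp).comp_mem _ _ key (of_isIso _ _))

/-- Very inner anodyne morphisms are surjective on trees with a single edge. -/
lemma mem_range_of_llp_rlp {A C : ClosedDendroidalSet} {i : A ⟶ C}
    (hi : VeryInnerHornInclusion.rlp.llp i) (S : ClosedTree) (y : C.obj (op S))
    (hS : ∀ s, s = S.obj.rootEdge) : y ∈ (Subfunctor.range i).obj (op S) := by
  -- The inclusion of this subfunctor lifts against very inner horns, because any map from a
  -- one-edge tree to `T` lies in the horn. Lifting `i` against it shows that `Z` is all of `C`.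
  let Z : Subfunctor C :=
    { obj := fun U => {x | ∀ (R : ClosedTree) (g : R ⟶ U.unop), (∀ s, s = R.obj.rootEdge) →
        C.map g.op x ∈ (Subfunctor.range i).obj (op R)}
      map := by
        intro U V h x hx R g hR
        rw [← Functor.map_comp_apply]
        exact hx R (g ≫ h.unop) hR }
  have hZ : VeryInnerHornInclusion.rlp Z.ι := by
    rintro _ _ _ ⟨T, e, he⟩
    refine ⟨fun {u v} sq => ?_⟩
    have hv : Subfunctor.range v ≤ Z := by
      rintro U _ ⟨f, rfl⟩ R g hR
      have hf : g ≫ f ∈ (horn T e).obj (op R) := by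
        rw [mem_horn_iff he]
        obtain ⟨her, x, hx⟩ := isVeryInner_iff.1 he
        have hrange : ∀ t ∈ Set.range (fn (g ≫ f)), t = fn (g ≫ f) R.obj.rootEdge := by
          rintro _ ⟨r, rfl⟩
          rw [hR r]
        by_cases h : x = fn (g ≫ f) R.obj.rootEdge
        · refine ⟨T.obj.rootEdge, her.symm, fun h' => ?_⟩
          have h2 := (rootEdge_lt her).trans hx
          rw [h, ← hrange _ h'] at h2
          exact h2.ne rfl
        · exact ⟨x, hx.ne', fun h' => h (hrange _ h')⟩
      have h1 : C.map g.op (v.app U f) = v.app (op R) (g ≫ f) :=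
        (NatTrans.naturality_apply v g.op f).symm
      have h2 : v.app (op R) (g ≫ f) = (u.app (op R) ⟨g ≫ f, hf⟩).1 :=
        (types_congr_hom (congr_app sq.w (op R)) ⟨g ≫ f, hf⟩).symm
      have h3 := (u.app (op R) ⟨g ≫ f, hf⟩).2 R (𝟙 R) hR
      rw [op_id, Functor.map_id_apply, ← h2] at h3
      rwa [h1]
    exact ⟨⟨⟨Subfunctor.lift v hv, by rw [← cancel_mono Z.ι, Category.assoc, Subfunctor.lift_ι, sq.w],
      Subfunctor.lift_ι v hv⟩⟩⟩
  have hle : Subfunctor.range i ≤ Z := fun U x hx R g _ => (Subfunctor.range i).map g.op hx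
  have := hi _ hZ
  have sq : CommSq (Subfunctor.lift i hle) i Z.ι (𝟙 C) := ⟨by simp⟩
  have h1 := types_congr_hom (congr_app sq.fac_right (op S)) y
  have h2 := (sq.lift.app (op S) y).2 S (𝟙 S) hS
  rw [op_id, Functor.map_id_apply] at h2
  exact Eq.mp (congrArg (· ∈ (Subfunctor.range i).obj (op S)) h1) h2

/-! ### Cylinders and right cancellation -/

/-- The projection of a tensor product to its second factor. -/
def sndHom (L F : ClosedDendroidalSet) : (L ⊗ F : ClosedDendroidalSet) ⟶ F where
  app _ := TypeCat.ofHom fun x => x.2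

/-- The inclusion of the end of the cylinder with labels `true`. -/
def trueEnd (F : ClosedDendroidalSet) : F ⟶ (labelings ⊗ F : ClosedDendroidalSet) where
  app U := TypeCat.ofHom fun x => ((fun _ => true : U.unop.obj.Edge → Bool), x)

open Classical in
/-- A morphism on both ends of a cylinder, from morphisms on each end. -/
noncomputable def endsHom {F E : ClosedDendroidalSet} (a b : F ⟶ E) :
    (bothEnds.toFunctor ⊗ F : ClosedDendroidalSet) ⟶ E where
  app U := TypeCat.ofHom fun x => if x.1.1 ∈ falseEnd.obj U then a.app U x.2 else b.app U x.2
  naturality U V g := by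
    ext x
    have h : (labelings.map g x.1.1 ∈ falseEnd.obj V) ↔ x.1.1 ∈ falseEnd.obj U := by
      refine ⟨fun h => ?_, fun h => falseEnd.map g h⟩
      rcases x.1.2 with h' | h'
      · exact h'
      · have h1 := h V.unop.obj.rootEdge
        exact absurd ((h' (fn g.unop V.unop.obj.rootEdge)).symm.trans h1) (by simp)
    change (if labelings.map g x.1.1 ∈ falseEnd.obj V then a.app V (F.map g x.2) else
      b.app V (F.map g x.2)) = E.map g (if x.1.1 ∈ falseEnd.obj U then a.app U x.2 else
        b.app U x.2)
    by_cases hx : x.1.1 ∈ falseEnd.obj U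
    · rw [if_pos hx, if_pos (h.2 hx)]
      exact NatTrans.naturality_apply a g x.2
    · rw [if_neg hx, if_neg (fun h' => hx (h.1 h'))]
      exact NatTrans.naturality_apply b g x.2

lemma endsHom_of_mem {F E : ClosedDendroidalSet} (a b : F ⟶ E) {U : ClosedTreeᵒᵖ}
    (x : (bothEnds.toFunctor ⊗ F : ClosedDendroidalSet).obj U) (h : x.1.1 ∈ falseEnd.obj U) :
    (endsHom a b).app U x = a.app U x.2 := if_pos h

lemma endsHom_of_notMem {F E : ClosedDendroidalSet} (a b : F ⟶ E) {U : ClosedTreeᵒᵖ}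
    (x : (bothEnds.toFunctor ⊗ F : ClosedDendroidalSet).obj U) (h : x.1.1 ∉ falseEnd.obj U) :
    (endsHom a b).app U x = b.app U x.2 := if_neg h

theorem hasRightCancellation_via : HasRightCancellation via := by
  rw [via_eq_llp_rlp]
  intro A B C i j _ hjn hi hij
  obtain ⟨E, k, p, hkp, hk, hp⟩ : ∃ (E : ClosedDendroidalSet) (k : B ⟶ E) (p : E ⟶ C), k ≫ p = j ∧
      VeryInnerHornInclusion.rlp.llp k ∧ VeryInnerHornInclusion.rlp p := by
    let d := MorphismProperty.factorizationData VeryInnerHornInclusion.rlp.llp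
      VeryInnerHornInclusion.rlp j
    exact ⟨_, d.i, d.p, d.fac, d.hi, d.hp⟩
  have hs : ∃ s : C ⟶ E, (i ≫ j) ≫ s = i ≫ k ∧ s ≫ p = 𝟙 C := by
    have := hij _ hp
    have sq : CommSq (i ≫ k) (i ≫ j) p (𝟙 C) := ⟨by simp [hkp]⟩
    exact ⟨sq.lift, sq.fac_left, sq.fac_right⟩
  obtain ⟨s, hs, hsp⟩ := hs
  have hhorn : ∀ {X Y : ClosedDendroidalSet} (g : X ⟶ Y), VeryInnerHornInclusion g →
      ∃ sq : (curriedTensor ClosedDendroidalSet).PushoutObjObj bothEnds.ι g,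
        HasLiftingProperty sq.ι p := by
    rintro _ _ _ ⟨T, e, he⟩
    refine ⟨prodSubPushout _ _, ?_⟩
    change HasLiftingProperty (prodSub bothEnds (horn T e)).ι p
    rw [prodSub_bothEnds_horn T e he]
    exact llp_rlp_hornPrism T e he _ hp
  have hbd : ∀ {X Y : ClosedDendroidalSet} (g : X ⟶ Y), BoundaryInclusion g →
      ∃ sq : (curriedTensor ClosedDendroidalSet).PushoutObjObj falseEnd.ι g,
        HasLiftingProperty sq.ι p := by
    rintro _ _ _ ⟨T, x, hx⟩
    refine ⟨prodSubPushout _ _, ?_⟩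
    change HasLiftingProperty (prodSub falseEnd (boundary T)).ι p
    rw [prodSub_falseEnd_boundary T]
    exact llp_rlp_boundaryPrism T x hx _ hp
  -- One-edge trees are excluded from `BoundaryInclusion`; on them `j` is surjective since `i ≫ j`
  -- is.
  have hjI : BoundaryInclusion.rlp.llp j := by
    refine hjn.llp_rlp_boundaryInclusion fun S y hS => ?_
    obtain ⟨x, rfl⟩ := mem_range_of_llp_rlp hij S y hS
    exact ⟨i.app _ x, rfl⟩
  have happ : ∀ {X Y : ClosedDendroidalSet} {f g : X ⟶ Y}, f = g → ∀ U x, f.app U x = g.app U x :=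
    fun h U x => h ▸ rfl
  -- A homotopy over `C` from `j ≫ s` to `k`, constant on `A`.
  obtain ⟨H, -, hH2, hH3⟩ := exists_lift_of_llp_rlp bothEnds _ p hhorn hi
    (sndHom labelings A ≫ i ≫ k) (endsHom (j ≫ s) k) (sndHom labelings B ≫ j)
    (by
      ext U x
      by_cases h : x.1.1 ∈ falseEnd.obj U
      · exact ((endsHom_of_mem (j ≫ s) k (x.1, i.app U x.2) h).trans (happ hs U x.2)).symm
      · exact (endsHom_of_notMem (j ≫ s) k (x.1, i.app U x.2) h).symm)
    (by
      rw [Category.assoc, Category.assoc, hkp]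
      rfl)
    (by
      ext U x
      by_cases h : x.1.1 ∈ falseEnd.obj U
      · refine (congrArg (p.app U) (endsHom_of_mem (j ≫ s) k x h)).trans ?_
        exact happ hsp U (j.app U x.2)
      · refine (congrArg (p.app U) (endsHom_of_notMem (j ≫ s) k x h)).trans ?_
        exact happ hkp U x.2)
  -- The homotopy `H` extends along `j` with initial value `s`. The other end of `G` is the
  -- corrected section of `p`, which exhibits `j` as a retract of `k`.
  obtain ⟨G, hG1, -, hG3⟩ := exists_lift_of_llp_rlp falseEnd _ p hbd hjI
    H (sndHom falseEnd.toFunctor C ≫ s) (sndHom labelings C)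
    (by
      ext U x
      refine (happ hH2 U (⟨x.1.1, Or.inl x.1.2⟩, x.2)).trans ?_
      exact endsHom_of_mem (j ≫ s) k _ x.1.2)
    hH3
    (by rw [Category.assoc, hsp]; rfl)
  have h1 : j ≫ trueEnd C ≫ G = k := by
    have h2 : j ≫ trueEnd C = trueEnd B ≫ labelings ◁ j := rfl
    rw [reassoc_of% h2, hG1]
    ext U x
    refine (happ hH2 U (⟨fun _ => true, Or.inr fun _ => rfl⟩, x)).trans ?_
    exact endsHom_of_notMem (j ≫ s) k _ fun h => by simpa using h U.unop.obj.rootEdge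
  have h2 : (trueEnd C ≫ G) ≫ p = 𝟙 C := by
    rw [Category.assoc, hG3]
    rfl
  intro X Y q hq
  refine ⟨fun {a b} sq => ?_⟩
  have := hk q hq
  have sq' : CommSq a k q (p ≫ b) := ⟨by rw [sq.w, reassoc_of% hkp]⟩
  refine ⟨⟨⟨(trueEnd C ≫ G) ≫ sq'.lift, ?_, ?_⟩⟩⟩
  · rw [← Category.assoc, h1, sq'.fac_left]
  · rw [Category.assoc, sq'.fac_right, ← Category.assoc, h2, Category.id_comp]

/-! ### Families of subtrees -/

/-- The sets of edges of a tree which have a least element, that is, its subtrees. -/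
abbrev Subtree (T : ClosedTree) : Type :=
  {A : Finset T.obj.Edge // ∃ r ∈ A, ∀ a ∈ A, r ≤ a}

section

variable {T : ClosedTree}

/-- The subtrees contained in `B`. -/
def fullFamily (B : Finset T.obj.Edge) : LowerSet (Subtree T) where
  carrier := {A | A.1 ⊆ B}
  lower' _ _ h hA := Finset.Subset.trans h hA

/-- The subtrees of the corollas of `B`. -/
def spineFamily (B : Finset T.obj.Edge) : LowerSet (Subtree T) where
  carrier := {A | A.1 ⊆ B ∧ ∃ v ∈ B, ∀ a ∈ A.1, a = v ∨ v < a ∧ ∀ b ∈ B, v < b → ¬ b < a}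
  lower' := by
    rintro A A' h ⟨h1, v, hv, h2⟩
    exact ⟨Finset.Subset.trans h h1, v, hv, fun a ha => h2 a (h ha)⟩

/-- The subtrees of `B` which avoid some element of `F`. -/
def avoidFamily (B F : Finset T.obj.Edge) : LowerSet (Subtree T) where
  carrier := {A | A.1 ⊆ B ∧ ∃ d ∈ F, d ∉ A.1}
  lower' := by
    rintro A A' h ⟨h1, d, hd, h2⟩
    exact ⟨Finset.Subset.trans h h1, d, hd, fun ha => h2 (h ha)⟩

/-- The subtrees of `B` which lie above some element of `C`. -/
def branchFamily (B C : Finset T.obj.Edge) : LowerSet (Subtree T) where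
  carrier := {A | A.1 ⊆ B ∧ ∃ c ∈ C, ∀ a ∈ A.1, c ≤ a}
  lower' := by
    rintro A A' h ⟨h1, d, hd, h2⟩
    exact ⟨Finset.Subset.trans h h1, d, hd, fun a ha => h2 a (h ha)⟩

lemma mem_fullFamily {B : Finset T.obj.Edge} {A : Subtree T} :
    A ∈ fullFamily B ↔ A.1 ⊆ B := Iff.rfl

lemma mem_spineFamily {B : Finset T.obj.Edge} {A : Subtree T} :
    A ∈ spineFamily B ↔
      A.1 ⊆ B ∧ ∃ v ∈ B, ∀ a ∈ A.1, a = v ∨ v < a ∧ ∀ b ∈ B, v < b → ¬ b < a := Iff.rfl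

lemma mem_avoidFamily {B F : Finset T.obj.Edge} {A : Subtree T} :
    A ∈ avoidFamily B F ↔ A.1 ⊆ B ∧ ∃ d ∈ F, d ∉ A.1 := Iff.rfl

lemma mem_branchFamily {B C : Finset T.obj.Edge} {A : Subtree T} :
    A ∈ branchFamily B C ↔ A.1 ⊆ B ∧ ∃ c ∈ C, ∀ a ∈ A.1, c ≤ a := Iff.rfl

lemma avoidFamily_le_fullFamily (B F : Finset T.obj.Edge) : avoidFamily B F ≤ fullFamily B :=
  fun _ h => h.1

lemma spineFamily_le_fullFamily (B : Finset T.obj.Edge) : spineFamily B ≤ fullFamily B :=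
  fun _ h => h.1

lemma avoidFamily_insert (B F : Finset T.obj.Edge) (d : T.obj.Edge) :
    avoidFamily B (insert d F) = avoidFamily B F ⊔ fullFamily (B.erase d) := by
  ext A
  simp only [SetLike.mem_coe, LowerSet.mem_sup_iff, mem_avoidFamily, mem_fullFamily,
    Finset.exists_mem_insert, Finset.subset_erase]
  rw [and_or_left, or_comm]

lemma avoidFamily_inf_fullFamily_erase (B F : Finset T.obj.Edge) (d : T.obj.Edge) :
    avoidFamily B F ⊓ fullFamily (B.erase d) = avoidFamily (B.erase d) F := by
  ext A
  simp only [SetLike.mem_coe, LowerSet.mem_inf_iff, mem_avoidFamily, mem_fullFamily,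
    Finset.subset_erase]
  tauto

/-- Removing a topmost edge only shrinks corollas; contracting an edge with something above it would
merge two of them. -/
lemma spineFamily_inf_fullFamily_erase (B : Finset T.obj.Edge) (t : T.obj.Edge)
    (ht : ∀ b ∈ B, ¬ t < b) :
    spineFamily B ⊓ fullFamily (B.erase t) = spineFamily (B.erase t) := by
  ext A
  simp only [SetLike.mem_coe, LowerSet.mem_inf_iff, mem_spineFamily, mem_fullFamily]
  constructor
  · rintro ⟨⟨hAB, v, hv, h⟩, hA⟩
    refine ⟨hA, v, Finset.mem_erase.2 ⟨?_, hv⟩, fun a ha => (h a ha).imp_right fun h' =>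
      ⟨h'.1, fun b hb => h'.2 b (Finset.mem_of_mem_erase hb)⟩⟩
    rintro rfl
    obtain ⟨r, hr, -⟩ := A.2
    have hrv := Finset.mem_erase.1 (hA hr)
    rcases h r hr with h' | h'
    · exact hrv.1 h'
    · exact ht r hrv.2 h'.1
  · rintro ⟨hA, v, hv, h⟩
    refine ⟨⟨hA.trans (Finset.erase_subset _ _), v, Finset.mem_of_mem_erase hv, fun a ha =>
      (h a ha).imp_right fun h' => ⟨h'.1, fun b hb hvb hba => ?_⟩⟩, hA⟩
    refine h'.2 b (Finset.mem_erase.2 ⟨?_, hb⟩) hvb hba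
    rintro rfl
    exact ht a (Finset.mem_of_mem_erase (hA ha)) hba

/-- A corolla whose output is not above `c` meets the branch at most in some of its inputs. These
are pairwise incomparable, so a subtree among them is a single edge, which belongs to the spine of
the branch. -/
lemma spineFamily_inf_fullFamily_filter (B : Finset T.obj.Edge) (c : T.obj.Edge)
    [DecidablePred (c ≤ ·)] :
    spineFamily B ⊓ fullFamily (B.filter (c ≤ ·)) = spineFamily (B.filter (c ≤ ·)) := by
  ext A
  simp only [SetLike.mem_coe, LowerSet.mem_inf_iff, mem_spineFamily, mem_fullFamily]
  constructor
  · rintro ⟨⟨hAB, v, hv, h⟩, hA⟩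
    refine ⟨hA, ?_⟩
    by_cases hcv : c ≤ v
    · exact ⟨v, Finset.mem_filter.2 ⟨hv, hcv⟩, fun a ha => (h a ha).imp_right fun h' =>
        ⟨h'.1, fun b hb => h'.2 b (Finset.mem_filter.1 hb).1⟩⟩
    · obtain ⟨r, hr, hrA⟩ := A.2
      have hlt : ∀ a ∈ A.1, v < a ∧ ∀ b ∈ B, v < b → ¬ b < a := by
        intro a ha
        rcases h a ha with rfl | h'
        · exact absurd (Finset.mem_filter.1 (hA ha)).2 hcv
        · exact h'
      refine ⟨r, hA hr, fun a ha => Or.inl ?_⟩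
      rcases (hrA a ha).eq_or_lt with h' | h'
      · exact h'.symm
      · exact absurd h' ((hlt a ha).2 r (hAB hr) (hlt r hr).1)
  · rintro ⟨hA, v, hv, h⟩
    rw [Finset.mem_filter] at hv
    refine ⟨⟨hA.trans (Finset.filter_subset _ _), v, hv.1, fun a ha =>
      (h a ha).imp_right fun h' => ⟨h'.1, fun b hb hvb hba => ?_⟩⟩, hA⟩
    exact h'.2 b (Finset.mem_filter.2 ⟨hb, hv.2.trans hvb.le⟩) hvb hba

/-- A relation between families of subtrees which behaves like the class of inclusions belonging
to a saturated class with right cancellation. -/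
structure IsCancellative (V : LowerSet (Subtree T) → LowerSet (Subtree T) → Prop) : Prop where
  refl (P) : V P P
  trans {P Q R} : V P Q → V Q R → V P R
  glue {P Q} : V (P ⊓ Q) Q → V P (P ⊔ Q)
  cancel {P Q R} : V P Q → V P R → Q ≤ R → V Q R

variable {V : LowerSet (Subtree T) → LowerSet (Subtree T) → Prop} (hV : IsCancellative V) {n : ℕ}
  (hn : ∀ (B : Finset T.obj.Edge), (∃ r ∈ B, ∀ b ∈ B, r ≤ b) → B.card < n →
    V (spineFamily B) (fullFamily B))

include hV hn

/-- Branches over different children of `r` are disjoint, so each new branch meets what is already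
there exactly in its own spine. As `r` is not in it, the branch is smaller than `B` and `hn`
applies. -/
lemma spineFamily_sup_branchFamily (B C : Finset T.obj.Edge) (r : T.obj.Edge) (hr : r ∈ B)
    (hB : B.card ≤ n) (hC : ∀ c ∈ C, c ∈ B ∧ r < c ∧ ∀ b ∈ B, r < b → ¬ b < c) :
    V (spineFamily B) (spineFamily B ⊔ branchFamily B C) := by
  classical
  induction C using Finset.induction_on with
  | empty =>
    have : branchFamily B ∅ = ⊥ := by
      ext A
      simp [mem_branchFamily]
    rw [this, sup_bot_eq]
    exact hV.refl _
  | insert c C hcC ih =>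
    have ih := ih fun c hc => hC c (Finset.mem_insert_of_mem hc)
    obtain ⟨hcB, hrc, hc⟩ := hC c (Finset.mem_insert_self _ _)
    have h1 : branchFamily B (insert c C) = branchFamily B C ⊔ fullFamily (B.filter (c ≤ ·)) := by
      ext A
      simp only [SetLike.mem_coe, LowerSet.mem_sup_iff, mem_branchFamily, mem_fullFamily,
        Finset.exists_mem_insert, Finset.subset_iff, Finset.mem_filter]
      grind
    have h2 : (spineFamily B ⊔ branchFamily B C) ⊓ fullFamily (B.filter (c ≤ ·)) =
        spineFamily (B.filter (c ≤ ·)) := by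
      rw [inf_sup_right, spineFamily_inf_fullFamily_filter, sup_eq_left]
      rintro A ⟨⟨hAB, d, hd, hA⟩, hA'⟩
      exfalso
      obtain ⟨s, hs, -⟩ := A.2
      have h3 := hA s hs
      have h4 := (Finset.mem_filter.1 (hA' hs)).2
      obtain ⟨hdB, hrd, hd'⟩ := hC d (Finset.mem_insert_of_mem hd)
      have h5 : c ≠ d := fun h => hcC (h ▸ hd)
      rcases Tree.le_or_le_of_le h3 h4 with h | h
      · exact hc d hdB hrd (lt_of_le_of_ne h h5.symm)
      · exact hd' c hcB hrc (lt_of_le_of_ne h h5)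
    rw [h1, ← sup_assoc]
    refine hV.trans ih (hV.glue ?_)
    rw [h2]
    refine hn _ ⟨c, Finset.mem_filter.2 ⟨hcB, le_rfl⟩, fun b hb => (Finset.mem_filter.1 hb).2⟩ ?_
    refine (Finset.card_lt_card (Finset.filter_ssubset.2 ⟨r, hr, hrc.not_ge⟩)).trans_le hB

/-- Avoiding the root means lying in a branch, which settles the case without top edges. The face
omitting a top edge `t` meets the union built so far in the same kind of union for `B.erase t`;
induction, `hn` and cancellation allow it to be glued on. -/
lemma spineFamily_sup_avoidFamily (B F : Finset T.obj.Edge) (r : T.obj.Edge) (hr : r ∈ B)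
    (hrB : ∀ b ∈ B, r ≤ b) (hB : B.card ≤ n)
    (hF : ∀ t ∈ F, t ∈ B ∧ t ≠ r ∧ ∀ b ∈ B, ¬ t < b) :
    V (spineFamily B) (spineFamily B ⊔ avoidFamily B (insert r F)) := by
  classical
  induction F using Finset.induction_on generalizing B with
  | empty =>
    have h1 : avoidFamily B (insert r ∅) =
        branchFamily B (B.filter fun c => r < c ∧ ∀ b ∈ B, r < b → ¬ b < c) := by
      ext A
      simp only [SetLike.mem_coe, mem_branchFamily, mem_avoidFamily, insert_empty_eq,
        Finset.mem_singleton, exists_eq_left]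
      refine and_congr_right fun hA => ⟨fun hrA => ?_, ?_⟩
      · obtain ⟨s, hs, hsA⟩ := A.2
        have hrs : r < s := lt_of_le_of_ne (hrB s (hA hs)) fun h => hrA (h ▸ hs)
        obtain ⟨c, hc⟩ := (B.filter fun c => r < c ∧ c ≤ s).exists_minimal
          ⟨s, Finset.mem_filter.2 ⟨hA hs, hrs, le_rfl⟩⟩
        obtain ⟨hcB, hrc, hcs⟩ := Finset.mem_filter.1 hc.prop
        refine ⟨c, Finset.mem_filter.2 ⟨hcB, hrc, fun b hb hrb hbc => ?_⟩,
          fun a ha => hcs.trans (hsA a ha)⟩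
        exact hc.not_lt (Finset.mem_filter.2 ⟨hb, hrb, hbc.le.trans hcs⟩) hbc
      · rintro ⟨c, hc, hcA⟩ hrA
        exact (Finset.mem_filter.1 hc).2.1.not_ge (hcA r hrA)
    rw [h1]
    exact spineFamily_sup_branchFamily hV hn B _ r hr hB fun c hc => Finset.mem_filter.1 hc
  | insert t F htF ih =>
    obtain ⟨htB, htr, ht⟩ := hF t (Finset.mem_insert_self _ _)
    have hF' : ∀ u ∈ F, u ∈ B ∧ u ≠ r ∧ ∀ b ∈ B, ¬ u < b :=
      fun u hu => hF u (Finset.mem_insert_of_mem hu)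
    have hcard := Finset.card_erase_lt_of_mem htB
    have hr' : r ∈ B.erase t := Finset.mem_erase.2 ⟨htr.symm, hr⟩
    have hrB' : ∀ b ∈ B.erase t, r ≤ b := fun b hb => hrB b (Finset.mem_of_mem_erase hb)
    rw [Finset.insert_comm, avoidFamily_insert, ← sup_assoc]
    refine hV.trans (ih B hr hrB hB hF') (hV.glue ?_)
    rw [inf_sup_right, spineFamily_inf_fullFamily_erase B t ht, avoidFamily_inf_fullFamily_erase]
    refine hV.cancel (ih (B.erase t) hr' hrB' (hcard.le.trans hB) ?_)
      (hn _ ⟨r, hr', hrB'⟩ (hcard.trans_le hB))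
      (sup_le (spineFamily_le_fullFamily _) (avoidFamily_le_fullFamily _ _))
    intro u hu
    obtain ⟨h1, h2, h3⟩ := hF' u hu
    exact ⟨Finset.mem_erase.2 ⟨fun h => htF (h ▸ hu), h1⟩, h2,
      fun b hb => h3 b (Finset.mem_of_mem_erase hb)⟩

/-- The inclusion of the spine into a union of faces, including the root face and all the top
faces but not the face which contracts a certain inner edge `e`. -/
lemma spineFamily_avoidFamily (B F : Finset T.obj.Edge) (r e x : T.obj.Edge) (hr : r ∈ B)
    (hrB : ∀ b ∈ B, r ≤ b) (hB : B.card ≤ n) (he : e ∈ B) (hre : r < e) (hx : x ∈ B)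
    (hex : e < x) (hF : F ⊆ B) (heF : e ∉ F) (hrF : r ∈ F)
    (hmax : ∀ t ∈ B, (∀ b ∈ B, ¬ t < b) → t ∈ F) :
    V (spineFamily B) (avoidFamily B F) := by
  classical
  obtain ⟨m, hm⟩ : ∃ m, B.card + F.card = m := ⟨_, rfl⟩
  induction m using Nat.strong_induction_on generalizing B F x with
  | _ m ih =>
  subst hm
  by_cases hd : ∃ d ∈ F, d ≠ r ∧ ∃ b ∈ B, d < b
  · obtain ⟨d, hdF, hdr, b, hb, hdb⟩ := hd
    have hdB := hF hdF
    have hed : e ≠ d := fun h => heF (h ▸ hdF)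
    have hcardF := Finset.card_erase_lt_of_mem hdF
    have hcardB := Finset.card_erase_lt_of_mem hdB
    have hmax' : ∀ t ∈ B, (∀ b ∈ B, ¬ t < b) → t ∈ F.erase d := by
      intro t ht h
      refine Finset.mem_erase.2 ⟨?_, hmax t ht h⟩
      rintro rfl
      exact h b hb hdb
    have hrF' : r ∈ F.erase d := Finset.mem_erase.2 ⟨hdr.symm, hrF⟩
    have heF' : e ∉ F.erase d := fun h => heF (Finset.mem_of_mem_erase h)
    have hr' : r ∈ B.erase d := Finset.mem_erase.2 ⟨hdr.symm, hr⟩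
    have hrB' : ∀ b ∈ B.erase d, r ≤ b := fun b hb => hrB b (Finset.mem_of_mem_erase hb)
    -- As `d` has an edge above it, contracting it creates no new topmost edge, so the hypotheses on
    -- `e` and on the top edges pass to `B.erase d`.
    have habove : ∀ t ∈ B, ∀ b ∈ B, t < b → ∃ b ∈ B.erase d, t < b := by
      intro t ht b' hb' htb
      by_cases h : b' = d
      · exact ⟨b, Finset.mem_erase.2 ⟨hdb.ne', hb⟩, htb.trans (h ▸ hdb)⟩
      · exact ⟨b', Finset.mem_erase.2 ⟨h, hb'⟩, htb⟩
    have h1 := ih (B.card + (F.erase d).card) (by omega) B (F.erase d) x hr hrB hB he hx hex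
      ((Finset.erase_subset _ _).trans hF) heF' hrF' hmax' rfl
    obtain ⟨x', hx', hex'⟩ := habove e he x hx hex
    have h2 := ih ((B.erase d).card + (F.erase d).card) (by omega) (B.erase d) (F.erase d) x'
      hr' hrB' (hcardB.le.trans hB) (Finset.mem_erase.2 ⟨hed, he⟩) hx' hex'
      (Finset.erase_subset_erase d hF) heF' hrF' (by
        intro t ht h
        refine hmax' t (Finset.mem_of_mem_erase ht) fun b' hb' htb => ?_
        obtain ⟨b'', h3, h4⟩ := habove t (Finset.mem_of_mem_erase ht) b' hb' htb
        exact h b'' h3 h4) rfl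
    rw [← Finset.insert_erase hdF, avoidFamily_insert]
    refine hV.trans h1 (hV.glue ?_)
    rw [avoidFamily_inf_fullFamily_erase]
    exact hV.cancel h2 (hn _ ⟨r, hr', hrB'⟩ (hcardB.trans_le hB)) (avoidFamily_le_fullFamily _ _)
  · push Not at hd
    have h1 := spineFamily_sup_avoidFamily hV hn B (F.erase r) r hr hrB hB (by
      intro t ht
      obtain ⟨h1, h2⟩ := Finset.mem_erase.1 ht
      exact ⟨hF h2, h1, hd t h2 h1⟩)
    rw [Finset.insert_erase hrF] at h1
    -- A corolla not at the root misses `r`. The root corolla misses any topmost edge above `x`,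
    -- since `e` lies strictly between that edge and `r`.
    have h2 : spineFamily B ≤ avoidFamily B F := by
      rintro A ⟨hAB, v, hv, hA⟩
      refine ⟨hAB, ?_⟩
      by_cases hvr : v = r
      · subst hvr
        obtain ⟨t, ht⟩ := (B.filter (x ≤ ·)).exists_maximal
          ⟨x, Finset.mem_filter.2 ⟨hx, le_rfl⟩⟩
        obtain ⟨htB, hxt⟩ := Finset.mem_filter.1 ht.prop
        have het := hex.trans_le hxt
        refine ⟨t, hmax t htB fun b hb htb =>
          ht.not_gt (Finset.mem_filter.2 ⟨hb, hxt.trans htb.le⟩) htb, fun htA => ?_⟩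
        rcases hA t htA with h | h
        · exact (hre.trans het).ne' h
        · exact h.2 e he hre het
      · refine ⟨r, hrF, fun hrA => ?_⟩
        rcases hA r hrA with h | h
        · exact hvr h.symm
        · exact (hrB v hv).not_gt h.1
    rwa [sup_eq_right.2 h2] at h1

end

/-! ### From families of subtrees to inclusions of presheaves -/

section

variable {W : MorphismProperty ClosedDendroidalSet} (hW : IsSaturated W)

include hW

lemma IsSaturated.comp {X Y Z : ClosedDendroidalSet} {f : X ⟶ Y} {g : Y ⟶ Z} (hf : W f)
    (hg : W g) : W (f ≫ g) := by
  have := hW.transfinite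
  exact W.comp_mem _ _ hf hg

lemma IsSaturated.of_isIso {X Y : ClosedDendroidalSet} (f : X ⟶ Y) [IsIso f] : W f := by
  have := hW.transfinite
  have := hW.pushouts
  exact MorphismProperty.of_isIso W f

/-- A union of subpresheaves is the pushout over their intersection. -/
lemma IsSaturated.homOfLe_sup {Y : ClosedDendroidalSet} (P Q : Subfunctor Y)
    (h : W (Subfunctor.homOfLe (inf_le_right : P ⊓ Q ≤ Q))) :
    W (Subfunctor.homOfLe (le_sup_left : P ≤ P ⊔ Q)) := by
  have := hW.pushouts
  have sq : IsPushout (Subfunctor.homOfLe (inf_le_left : P ⊓ Q ≤ P))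
      (Subfunctor.homOfLe (inf_le_right : P ⊓ Q ≤ Q))
      (Subfunctor.homOfLe (le_sup_left : P ≤ P ⊔ Q))
      (Subfunctor.homOfLe (le_sup_right : Q ≤ P ⊔ Q)) := by
    refine IsPushout.of_forall_isPushout_app fun U => ?_
    let val : (P ⊔ Q).toFunctor.obj U → Y.obj U := fun z => z.1
    have h₁ : Function.Injective ((Subfunctor.homOfLe (le_sup_left : P ≤ P ⊔ Q)).app U) :=
      fun x y h => Subtype.ext (congrArg val h)
    have h₂ : Function.Injective ((Subfunctor.homOfLe (le_sup_right : Q ≤ P ⊔ Q)).app U) :=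
      fun x y h => Subtype.ext (congrArg val h)
    have := (mono_iff_injective _).2 h₁
    refine Types.isPushout_of_isPullback_of_mono' ?_ ?_ fun x y _ _ h => h₂ h
    · rw [Types.isPullback_iff]
      refine ⟨rfl, fun x y h => Subtype.ext (congrArg (fun z : P.toFunctor.obj U => z.1) h.1),
        fun x y h => ?_⟩
      have hxy : x.1 = y.1 := congrArg val h
      exact ⟨⟨x.1, x.2, by rw [hxy]; exact y.2⟩, rfl, Subtype.ext hxy⟩
    · refine Set.eq_univ_of_forall ?_
      rintro ⟨x, hx | hx⟩
      · exact Or.inl ⟨⟨x, hx⟩, rfl⟩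
      · exact Or.inr ⟨⟨x, hx⟩, rfl⟩
  exact W.of_isPushout sq h

lemma IsSaturated.homOfLe_iff {Y : ClosedDendroidalSet} {P Q : Subfunctor Y} (h : P ≤ Q)
    (hQ : Q = ⊤) : W (Subfunctor.homOfLe h) ↔ W P.ι := by
  subst hQ
  have := hW.pushouts
  rw [← Subfunctor.homOfLe_ι h]
  exact (W.cancel_right_of_respectsIso _ _).symm

end

/-- Automorphisms act freely on all of a representable, since an automorphism over `T` is the
identity. Thus cancellation is always available among subpresheaves of `T`. -/
lemma isNormalMono_homOfLe {T : ClosedTree} {P Q : Subfunctor (yoneda.obj T)} (h : P ≤ Q) :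
    IsNormalMono (Subfunctor.homOfLe h) := by
  refine ⟨inferInstance, fun S y _ g hg => ?_⟩
  have h1 : g.hom ≫ (show S ⟶ T from y.1) = y.1 := congrArg Subtype.val hg
  refine Iso.ext (eq_id_of_comp_eq _ _ h1 fun s => ⟨fn g.inv s, ?_⟩)
  rw [← fn_comp, g.inv_hom_id, fn_id]

/-- The image of a morphism to `T`. -/
def subtreeOf {S T : ClosedTree} (f : S ⟶ T) : Subtree T :=
  ⟨Finset.univ.image (fn f), fn f S.obj.rootEdge, Finset.mem_image_of_mem _ (Finset.mem_univ _),
    fun a ha => by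
      obtain ⟨s, -, rfl⟩ := Finset.mem_image.1 ha
      exact fn_mono f (S.obj.rootEdge_le s)⟩

lemma mem_subtreeOf {S T : ClosedTree} {f : S ⟶ T} {t : T.obj.Edge} :
    t ∈ (subtreeOf f).1 ↔ ∃ s, fn f s = t := by
  simp [subtreeOf]

lemma subtreeOf_comp_le {R S T : ClosedTree} (g : R ⟶ S) (f : S ⟶ T) :
    subtreeOf (g ≫ f) ≤ subtreeOf f := by
  intro t ht
  obtain ⟨r, rfl⟩ := mem_subtreeOf.1 ht
  exact mem_subtreeOf.2 ⟨fn g r, rfl⟩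

/-- The morphisms to `T` whose image is in a given family of subtrees. -/
def faceSub {T : ClosedTree} (P : LowerSet (Subtree T)) : Subfunctor (yoneda.obj T) where
  obj U := {f | subtreeOf (show U.unop ⟶ T from f) ∈ P}
  map g f hf := P.lower (subtreeOf_comp_le g.unop (show _ ⟶ T from f)) hf

lemma mem_faceSub {S T : ClosedTree} {P : LowerSet (Subtree T)} {f : S ⟶ T} :
    f ∈ (faceSub P).obj (op S) ↔ subtreeOf f ∈ P := Iff.rfl

lemma faceSub_mono {T : ClosedTree} {P Q : LowerSet (Subtree T)} (h : P ≤ Q) :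
    faceSub P ≤ faceSub Q := fun _ _ hf => h hf

lemma faceSub_spineFamily_univ (T : ClosedTree) :
    faceSub (spineFamily (Finset.univ : Finset T.obj.Edge)) = closedSpine T := by
  ext U f
  refine Iff.trans ?_ (mem_closedSpine_iff (S := U.unop) f).symm
  refine (mem_faceSub (S := U.unop)).trans ?_
  simp only [mem_spineFamily, Finset.subset_univ, Finset.mem_univ, true_and, mem_subtreeOf,
    forall_exists_index, forall_apply_eq_imp_iff, CovBy, forall_const]

lemma faceSub_fullFamily_univ (T : ClosedTree) :
    faceSub (fullFamily (Finset.univ : Finset T.obj.Edge)) = ⊤ :=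
  top_le_iff.1 fun _ _ _ => Finset.subset_univ _

lemma faceSub_avoidFamily_univ {T : ClosedTree} {e : T.obj.Edge} (he : T.obj.IsVeryInner e) :
    faceSub (avoidFamily Finset.univ (Finset.univ.erase e)) = horn T e := by
  ext U f
  refine Iff.trans ?_ (mem_horn_iff (S := U.unop) he f).symm
  refine (mem_faceSub (S := U.unop)).trans ?_
  simp [mem_avoidFamily, mem_subtreeOf]

/-- The relation on families of subtrees which says that the inclusion is in `W`. -/
def FaceInclusion (W : MorphismProperty ClosedDendroidalSet) {T : ClosedTree}
    (P Q : LowerSet (Subtree T)) : Prop :=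
  ∃ h : P ≤ Q, W (Subfunctor.homOfLe (faceSub_mono h))

section

variable {W : MorphismProperty ClosedDendroidalSet} (hW : IsSaturated W)

include hW

lemma IsSaturated.isCancellative (hc : HasRightCancellation W) (T : ClosedTree) :
    IsCancellative (FaceInclusion W (T := T)) where
  refl P := ⟨le_rfl, by
    have : Subfunctor.homOfLe (le_refl (faceSub P)) = 𝟙 _ := rfl
    exact this ▸ hW.of_isIso (𝟙 _)⟩
  trans := by
    rintro P Q R ⟨h, hPQ⟩ ⟨h', hQR⟩
    exact ⟨h.trans h', hW.comp hPQ hQR⟩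
  glue := by
    rintro P Q ⟨h, hPQ⟩
    exact ⟨le_sup_left, hW.homOfLe_sup (faceSub P) (faceSub Q) hPQ⟩
  cancel := by
    rintro P Q R ⟨h, hPQ⟩ ⟨h', hPR⟩ hQR
    exact ⟨hQR, hc _ _ (isNormalMono_homOfLe (faceSub_mono h))
      (isNormalMono_homOfLe (faceSub_mono hQR)) hPQ hPR⟩

lemma IsSaturated.faceInclusion_fullFamily_univ_iff {T : ClosedTree} (P : LowerSet (Subtree T)) :
    FaceInclusion W P (fullFamily Finset.univ) ↔ W (faceSub P).ι := by
  have h : P ≤ fullFamily Finset.univ := fun A _ => Finset.subset_univ _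
  rw [← hW.homOfLe_iff (faceSub_mono h) (faceSub_fullFamily_univ T)]
  exact ⟨fun ⟨_, h'⟩ => h', fun h' => ⟨h, h'⟩⟩

/-- Composition with the injective `f` identifies `S` and its spine with the face on `B` and the
spine of that face, so the two inclusions are isomorphic arrows. -/
lemma IsSaturated.faceInclusion_of_closedSpine {S T : ClosedTree} (f : S ⟶ T)
    (hf : Function.Injective (fn f)) (hS : W (closedSpine S).ι) (B : Finset T.obj.Edge)
    (hB : Set.range (fn f) = B) : FaceInclusion W (spineFamily B) (fullFamily B) := by
  have hB' : ∀ t, t ∈ B ↔ ∃ s, fn f s = t := fun t => by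
    rw [← Finset.mem_coe, ← hB, Set.mem_range]
  have hlt : ∀ {s s'}, fn f s < fn f s' ↔ s < s' := fun {s s'} =>
    ⟨lt_of_fn_lt f, fun h => lt_of_le_of_ne (fn_mono f h.le) fun h' => h.ne (hf h')⟩
  have hfull : ∀ {R : ClosedTree} (g : R ⟶ S), subtreeOf (g ≫ f) ∈ fullFamily B := by
    intro R g t ht
    obtain ⟨r, rfl⟩ := mem_subtreeOf.1 ht
    exact (hB' _).2 ⟨fn g r, rfl⟩
  have hspine : ∀ {R : ClosedTree} (g : R ⟶ S),
      subtreeOf (g ≫ f) ∈ spineFamily B ↔ g ∈ (closedSpine S).obj (op R) := by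
    intro R g
    rw [mem_closedSpine_iff, mem_spineFamily, and_iff_right (mem_fullFamily.1 (hfull g))]
    simp only [hB', mem_subtreeOf, forall_exists_index, forall_apply_eq_imp_iff,
      exists_exists_eq_and, fn_comp, hf.eq_iff, hlt, CovBy]
  have := mono_of_injective f hf
  let α : (closedSpine S).toFunctor ⟶ (faceSub (spineFamily B)).toFunctor :=
    Subfunctor.lift ((closedSpine S).ι ≫ yoneda.map f) (by
      rintro U _ ⟨g, rfl⟩
      exact (hspine (R := U.unop) g.1).2 g.2)
  let β : yoneda.obj S ⟶ (faceSub (fullFamily B)).toFunctor :=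
    Subfunctor.lift (yoneda.map f) (by
      rintro U _ ⟨g, rfl⟩
      exact hfull (R := U.unop) g)
  have hex : ∀ {R : ClosedTree} (g : R ⟶ T), subtreeOf g ∈ fullFamily B → ∃ g', g' ≫ f = g := by
    intro R g hg
    refine exists_lift f g ?_
    rintro _ ⟨r, rfl⟩
    rw [hB]
    exact hg (mem_subtreeOf.2 ⟨r, rfl⟩)
  have hβ : IsIso β := by
    rw [NatTrans.isIso_iff_isIso_app]
    intro U
    rw [isIso_iff_bijective]
    refine ⟨fun g g' h => (cancel_mono f).1 (congrArg Subtype.val h), fun g => ?_⟩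
    obtain ⟨g', h⟩ := hex (R := U.unop) g.1 g.2
    exact ⟨g', Subtype.ext h⟩
  have hα : IsIso α := by
    rw [NatTrans.isIso_iff_isIso_app]
    intro U
    rw [isIso_iff_bijective]
    refine ⟨fun g g' h => Subtype.ext ((cancel_mono f).1 (congrArg Subtype.val h)), fun g => ?_⟩
    obtain ⟨g', h⟩ := hex (R := U.unop) g.1 (spineFamily_le_fullFamily B g.2)
    refine ⟨⟨g', (hspine (R := U.unop) g').1 ?_⟩, Subtype.ext h⟩
    rw [h]
    exact g.2
  have := hW.pushouts
  refine ⟨spineFamily_le_fullFamily B, ?_⟩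
  let a := asIso α
  let b := asIso β
  exact (W.arrow_mk_iso_iff (CategoryTheory.Arrow.isoMk a b rfl)).1 hS

/-- If the spine inclusions of all smaller trees are in `W`, then so is the inclusion of the spine
of `T` into each very inner horn of `T`. -/
lemma IsSaturated.faceInclusion_horn (hc : HasRightCancellation W) {T : ClosedTree}
    (hT : ∀ S : ClosedTree, Fintype.card S.obj.Edge < Fintype.card T.obj.Edge →
      W (closedSpine S).ι) {e : T.obj.Edge} (he : T.obj.IsVeryInner e) :
    FaceInclusion W (spineFamily Finset.univ) (avoidFamily Finset.univ (Finset.univ.erase e)) := by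
  obtain ⟨her, x, hx⟩ := isVeryInner_iff.1 he
  refine spineFamily_avoidFamily (hW.isCancellative hc T) (n := Fintype.card T.obj.Edge) ?_ _ _
    T.obj.rootEdge e x (Finset.mem_univ _) (fun b _ => T.obj.rootEdge_le b) le_rfl
    (Finset.mem_univ _) (rootEdge_lt her) (Finset.mem_univ _) hx (Finset.subset_univ _) (by simp)
    (by simp [her.symm]) ?_
  · rintro B ⟨r, hr, hrB⟩ hB
    obtain ⟨S, f, hf, hf', -⟩ := exists_subtree T B r hr hrB
    refine hW.faceInclusion_of_closedSpine f hf (hT S ?_) B hf'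
    have h1 : (Finset.univ.image (fn f)) = B := by
      rw [← Finset.coe_inj, ← hf']
      simp
    rw [← h1, Finset.card_image_of_injective _ hf] at hB
    exact hB
  · intro t _ ht
    refine Finset.mem_erase.2 ⟨?_, Finset.mem_univ _⟩
    rintro rfl
    exact ht x (Finset.mem_univ _) hx

/-- A saturated class with right cancellation which contains the spine inclusions contains the very
inner horn inclusions. -/
theorem IsSaturated.veryInnerHornInclusion_le (hc : HasRightCancellation W)
    (hs : ClosedSpineInclusion ≤ W) : VeryInnerHornInclusion ≤ W := by
  rintro _ _ _ ⟨T, e, he⟩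
  rw [← faceSub_avoidFamily_univ he, ← hW.faceInclusion_fullFamily_univ_iff]
  refine (hW.isCancellative hc T).cancel
    (hW.faceInclusion_horn hc (fun S _ => hs _ (ClosedSpineInclusion.mk S)) he) ?_
    (avoidFamily_le_fullFamily _ _)
  rw [hW.faceInclusion_fullFamily_univ_iff, faceSub_spineFamily_univ]
  exact hs _ (ClosedSpineInclusion.mk T)

/-- A saturated class with right cancellation which contains the very inner horn inclusions contains
the spine inclusions. -/
theorem IsSaturated.closedSpine_ι (hc : HasRightCancellation W) (hh : VeryInnerHornInclusion ≤ W)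
    (T : ClosedTree) : W (closedSpine T).ι := by
  obtain ⟨n, hn⟩ : ∃ n, Fintype.card T.obj.Edge = n := ⟨_, rfl⟩
  induction n using Nat.strong_induction_on generalizing T with
  | _ n ih =>
  subst hn
  by_cases hT : ∃ e, T.obj.IsVeryInner e
  · obtain ⟨e, he⟩ := hT
    rw [← faceSub_spineFamily_univ, ← hW.faceInclusion_fullFamily_univ_iff]
    refine (hW.isCancellative hc T).trans
      (hW.faceInclusion_horn hc (fun S hS => ih _ hS S rfl) he) ?_
    rw [hW.faceInclusion_fullFamily_univ_iff, faceSub_avoidFamily_univ he]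
    exact hh _ (VeryInnerHornInclusion.mk T e he)
  -- Without very inner edges nothing lies strictly between the root and another edge, so the root
  -- corolla is the whole tree.
  · have htop : closedSpine T = ⊤ := by
      refine top_le_iff.1 fun U f _ => ?_
      refine (mem_closedSpine_iff (S := U.unop) f).2 ⟨T.obj.rootEdge, fun s => ?_⟩
      by_cases hs : fn (show U.unop ⟶ T from f) s = T.obj.rootEdge
      · exact Or.inl hs
      · refine Or.inr ⟨rootEdge_lt hs, fun b hb hb' => hT ⟨b, ?_⟩⟩
        exact isVeryInner_iff.2 ⟨hb.ne', _, hb'⟩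
    rw [htop]
    exact hW.of_isIso _

end

end Dendroidal


theorem theorem7p6 :
    (∀ T : ClosedTree, via (closedSpine T).ι) ∧
      IsLeast {W : MorphismProperty ClosedDendroidalSet |
        IsSaturated W ∧ ClosedSpineInclusion ≤ W ∧ HasRightCancellation W} via := by
  have hspine := isSaturated_via.closedSpine_ι hasRightCancellation_via
    veryInnerHornInclusion_le_via
  refine ⟨hspine, ⟨isSaturated_via, ?_, hasRightCancellation_via⟩, ?_⟩
  · rintro _ _ _ ⟨T⟩
    exact hspine T
  · rintro W ⟨hW, hs, hc⟩ A B f hf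
    exact hf W hW (hW.veryInnerHornInclusion_le hc hs)
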